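/- Let $n\ge 1$, let $\lambda_0,\dots,\lambda_n\in\mathbb C$ with $\lambda_0=\lambda_1\in\mathbb R$, and let $$E=E_{(\lambda_0,\dots,\lambda_n)}=\Big\{f\in C^\infty(\mathbb R,\mathbb C): \Big(\tfrac{d}{dx}-\lambda_0\Big)\cdots\Big(\tfrac{d}{dx}-\lambda_n\Big)f=0\Big\}.$$ Suppose that $E$ is closed under complex conjugation ($f\in E\Rightarrow\overline f\in E$), and let $a,b\in\mathbb R$ satisfy $0<b-a<\pi/M_n$, where $M_n=\max\{|\operatorname{Im}\lambda_j|:0\le j\le n\}$ and $\pi/0:=\infty$. Then $E$ has a unique Bernstein basis with respect to $a,b$, that is, there are unique functions $p_{n,0},\dots,p_{n,n}\in E$ such that each $p_{n,k}$ has a zero of order exactly $k$ at $a$ and a zero of order exactly $n-k$ at $b$, and $p_{n,k}^{(k)}(a)=1$. Moreover, there exist unique nodes $a=t_0\le t_1\le\dots\le t_n=b$ and unique positive real numbers $\alpha_0,\dots,\alpha_n$ such that the operator $B$ defined for complex-valued $f\in C[a,b]$ by $$Bf=\sum_{k=0}^n\alpha_k f(t_k)\,p_{n,k}$$ fixes the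 functions $e^{\lambda_0x}$ and $xe^{\lambda_0x}$. (The two identities hold for all $x\in\mathbb R$, and already their validity for all $x\in[a,b]$ determines the nodes and weights.) -/

import Mathlib

open scoped ContDiff ComplexConjugate

noncomputable section

namespace ExpBernstein

/-- The first order operator `d/dx - c` on functions `ℝ → ℂ`. -/
def firstOrderOp (c : ℂ) (f : ℝ → ℂ) : ℝ → ℂ := fun x => deriv f x - c * f x

/-- The operator `L = (d/dx - λ₀) ⋯ (d/dx - λₙ)`. -/
def diffOp {n : ℕ} (Λ : Fin (n + 1) → ℂ) (f : ℝ → ℂ) : ℝ → ℂ :=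
  (List.ofFn Λ).foldr firstOrderOp f

/-- The space `E_(λ₀,…,λₙ)` of exponential polynomials: smooth `f : ℝ → ℂ` with `L f = 0`. -/
def expSpace {n : ℕ} (Λ : Fin (n + 1) → ℂ) : Set (ℝ → ℂ) :=
  {f | ContDiff ℝ ∞ f ∧ ∀ x, diffOp Λ f x = 0}

/-- A set of complex-valued functions is closed under complex conjugation. -/
def ClosedUnderConj (U : Set (ℝ → ℂ)) : Prop :=
  ∀ f ∈ U, (fun x => conj (f x)) ∈ U

/-- `f` has a zero of order (exactly) `k` at `c`. -/
def HasZeroOfOrder (f : ℝ → ℂ) (k : ℕ) (c : ℝ) : Prop :=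
  (∀ j < k, iteratedDeriv j f c = 0) ∧ iteratedDeriv k f c ≠ 0

/-- `p` is the (normalized) Bernstein basis of `E_(λ₀,…,λₙ)` with respect to `a`, `b`: `p k` lies
in the space, has a zero of order `k` at `a` and of order `n - k` at `b`, and its `k`-th derivative
at `a` is `1`. -/
def IsBernsteinBasis {n : ℕ} (Λ : Fin (n + 1) → ℂ) (a b : ℝ) (p : Fin (n + 1) → ℝ → ℂ) : Prop :=
  ∀ k : Fin (n + 1), p k ∈ expSpace Λ ∧
    HasZeroOfOrder (p k) (k : ℕ) a ∧ HasZeroOfOrder (p k) (n - (k : ℕ)) b ∧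
    iteratedDeriv (k : ℕ) (p k) a = 1

/-- `Mₙ = max {|Im λⱼ| : j = 0, …, n}`. -/
def maxAbsIm {n : ℕ} (Λ : Fin (n + 1) → ℂ) : ℝ :=
  Finset.univ.sup' Finset.univ_nonempty (fun j => |(Λ j).im|)

/-- The operator `B f = ∑ₖ αₖ f(tₖ) pₖ` for `f ∈ C[a,b]`; the values are functions on `ℝ`. -/
def bernsteinOp {n : ℕ} {a b : ℝ} (p : Fin (n + 1) → ℝ → ℂ) (t : Fin (n + 1) → Set.Icc a b)
    (α : Fin (n + 1) → ℝ) (f : C(Set.Icc a b, ℂ)) : ℝ → ℂ :=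
  fun x => ∑ k, (α k : ℂ) * f (t k) * p k x

/-- Admissible data: `a = t₀ ≤ t₁ ≤ … ≤ tₙ = b` and `αₖ > 0` for all `k`. -/
def AdmissibleData {n : ℕ} {a b : ℝ} (t : Fin (n + 1) → Set.Icc a b) (α : Fin (n + 1) → ℝ) : Prop :=
  (t 0 : ℝ) = a ∧ (t (Fin.last n) : ℝ) = b ∧ Monotone t ∧ ∀ k, 0 < α k

/-- The operator `B` reproduces `g` on the set `S`. -/
def FixesOn {n : ℕ} {a b : ℝ} (p : Fin (n + 1) → ℝ → ℂ) (t : Fin (n + 1) → Set.Icc a b)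
    (α : Fin (n + 1) → ℝ) (g : C(ℝ, ℂ)) (S : Set ℝ) : Prop :=
  ∀ x ∈ S, bernsteinOp p t α (g.restrict (Set.Icc a b)) x = g x

/-- The function `x ↦ e^{c x}`. -/
def expFun (c : ℂ) : C(ℝ, ℂ) := ⟨fun x => Complex.exp (c * x), by fun_prop⟩

/-- The function `x ↦ x e^{c x}`. -/
def mulExpFun (c : ℂ) : C(ℝ, ℂ) := ⟨fun x => (x : ℂ) * Complex.exp (c * x), by fun_prop⟩

end ExpBernstein

end

/-!
Closure under conjugation makes the characteristic polynomial `P` of the operator real. On an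
interval shorter than `π / Mₙ`, `P(d/dx)` is disconjugate: a nontrivial real solution has fewer
than `deg P` zeros, counted with multiplicity. To see this, split `P` into real factors and apply
Rolle's theorem to each: `D - α` is `D` conjugated by `e^{αx}`, and `(D - α)² + β²` is a product of
two such conjugates built from `e^{αx} cos β(x - m)`, which has no zero on the interval if `m` is
its midpoint. Disconjugacy gives existence and uniqueness of the Bernstein functions `p_k` of `P`
and their positivity on `(a, b)`.

Let `P = (X - r) Q`, and let `q_k` be the Bernstein functions of `Q`. Comparing zeros,
`(D - r) p_k = q_{k-1} - κ_k q_k`; here `κ_k > 0`, since `e^{-rx} p_k` is positive on `(a, b)`,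
vanishes at `b` and so has to decrease somewhere. Hence the coefficients of
`e^{rx} = ∑ c_k p_k` satisfy `c_{k+1} = κ_k c_k` and are positive. If moreover `Q = (X - r) R`, the
same holds for `e^{rx} = ∑ γ_k q_k`, and applying `D - r` to `x e^{rx} = ∑ c_k s_k p_k` yields
`c_{k+1} (s_{k+1} - s_k) = γ_k > 0`. So the `s_k` increase, from `a` to `b`: they are the nodes, and
the weights are `c_k e^{-r s_k}`.
-/

namespace ExpBernstein

open Polynomial

section Smooth

variable {𝕜 : Type*} [RCLike 𝕜]

variable (𝕜) in
/-- The algebra of smooth functions `ℝ → 𝕜`, on which differential operators with constant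
coefficients act linearly. -/
noncomputable def smoothFun : Subalgebra 𝕜 (ℝ → 𝕜) where
  carrier := {f | ContDiff ℝ ∞ f}
  mul_mem' {f g} (hf : ContDiff ℝ ∞ f) (hg : ContDiff ℝ ∞ g) := hf.mul hg
  add_mem' {f g} (hf : ContDiff ℝ ∞ f) (hg : ContDiff ℝ ∞ g) := hf.add hg
  algebraMap_mem' c := (contDiff_const : ContDiff ℝ ∞ fun _ : ℝ => c)

instance : CoeFun (smoothFun 𝕜) fun _ => ℝ → 𝕜 := ⟨Subtype.val⟩

theorem contDiff_smoothFun (f : smoothFun 𝕜) : ContDiff ℝ ∞ f := f.2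

theorem differentiable_smoothFun (f : smoothFun 𝕜) : Differentiable ℝ f :=
  (contDiff_smoothFun f).differentiable (by simp)

variable (𝕜) in
/-- Differentiation as an endomorphism of the space of smooth functions; `P(d/dx)` is
`aeval (derivOp 𝕜) P`. -/
noncomputable def derivOp : Module.End 𝕜 (smoothFun 𝕜) where
  toFun f := ⟨deriv f, (contDiff_infty_iff_deriv.1 (contDiff_smoothFun f)).2⟩
  map_add' f g := by
    ext x
    exact deriv_add (differentiable_smoothFun f x) (differentiable_smoothFun g x)
  map_smul' c f := by
    ext x
    exact deriv_const_smul c (differentiable_smoothFun f x)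

theorem hasDerivAt_smoothFun (f : smoothFun 𝕜) (x : ℝ) : HasDerivAt f (derivOp 𝕜 f x) x :=
  (differentiable_smoothFun f x).hasDerivAt

theorem derivOp_eq_of_hasDerivAt {f g : smoothFun 𝕜} (h : ∀ x, HasDerivAt f (g x) x) :
    derivOp 𝕜 f = g :=
  Subtype.ext <| funext fun x => (h x).deriv

theorem derivOp_mul (f g : smoothFun 𝕜) :
    derivOp 𝕜 (f * g) = derivOp 𝕜 f * g + f * derivOp 𝕜 g :=
  derivOp_eq_of_hasDerivAt fun x => (hasDerivAt_smoothFun f x).mul (hasDerivAt_smoothFun g x)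

theorem aeval_X_sub_C_apply (c : 𝕜) (f : smoothFun 𝕜) :
    aeval (derivOp 𝕜) (X - C c) f = derivOp 𝕜 f - c • f := by
  simp [Module.algebraMap_end_apply]

theorem aeval_mul_apply (P Q : 𝕜[X]) (f : smoothFun 𝕜) :
    aeval (derivOp 𝕜) (P * Q) f = aeval (derivOp 𝕜) P (aeval (derivOp 𝕜) Q f) := by
  rw [map_mul, Module.End.mul_apply]

/-- The functional `f ↦ f⁽ʲ⁾(x)` on smooth functions. -/
noncomputable def jet (x : ℝ) (j : ℕ) : smoothFun 𝕜 →ₗ[𝕜] 𝕜 :=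
  LinearMap.proj x ∘ₗ (smoothFun 𝕜).val.toLinearMap ∘ₗ (derivOp 𝕜 ^ j)

theorem jet_zero (x : ℝ) (f : smoothFun 𝕜) : jet x 0 f = f x := rfl

theorem jet_derivOp (x : ℝ) (j : ℕ) (f : smoothFun 𝕜) :
    jet x j (derivOp 𝕜 f) = jet x (j + 1) f := by
  simp only [jet, pow_succ]
  rfl

theorem jet_eq_iteratedDeriv (x : ℝ) (j : ℕ) (f : smoothFun 𝕜) :
    jet x j f = iteratedDeriv j f x := by
  induction j generalizing f with
  | zero => simp only [jet_zero, iteratedDeriv_zero]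
  | succ j ih => rw [← jet_derivOp, ih, iteratedDeriv_succ']; rfl

theorem hasDerivAt_jet (x : ℝ) (j : ℕ) (f : smoothFun 𝕜) :
    HasDerivAt (fun y => jet y j f) (jet x (j + 1) f) x := by
  induction j generalizing f with
  | zero => exact hasDerivAt_smoothFun f x
  | succ j ih => simpa only [jet_derivOp] using ih (derivOp 𝕜 f)

theorem jet_aeval (P : 𝕜[X]) (x : ℝ) (j : ℕ) (f : smoothFun 𝕜) :
    jet x j (aeval (derivOp 𝕜) P f) =
      ∑ k ∈ Finset.range (P.natDegree + 1), P.coeff k * jet x (j + k) f := by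
  have h_pow (k : ℕ) : jet x j ((derivOp 𝕜 ^ k) f) = jet x (j + k) f := by
    induction k generalizing f with
    | zero => rfl
    | succ k ih => rw [pow_succ, Module.End.mul_apply, ih, jet_derivOp, add_assoc]
  simp only [aeval_eq_sum_range, LinearMap.sum_apply, map_sum, LinearMap.smul_apply, map_smul,
    smul_eq_mul, h_pow]

theorem jet_X_sub_C (c : 𝕜) (x : ℝ) (j : ℕ) (f : smoothFun 𝕜) :
    jet x j (aeval (derivOp 𝕜) (X - C c) f) = jet x (j + 1) f - c * jet x j f := by
  rw [aeval_X_sub_C_apply, map_sub, jet_derivOp, map_smul, smul_eq_mul]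

variable (𝕜) in
/-- The smooth functions with a zero of order at least `k` at `c`. -/
noncomputable def vanishing (c : ℝ) (k : ℕ) : Submodule 𝕜 (smoothFun 𝕜) :=
  ⨅ j : Fin k, LinearMap.ker (jet c j)

theorem mem_vanishing {c : ℝ} {k : ℕ} {f : smoothFun 𝕜} :
    f ∈ vanishing 𝕜 c k ↔ ∀ j < k, jet c j f = 0 := by
  simp only [vanishing, Submodule.mem_iInf, LinearMap.mem_ker, Fin.forall_iff]

theorem vanishing_antitone (c : ℝ) : Antitone (vanishing 𝕜 c) := fun _ _ hkl _ hf =>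
  mem_vanishing.2 fun j hj => mem_vanishing.1 hf j (hj.trans_le hkl)

theorem mem_vanishing_zero (c : ℝ) (f : smoothFun 𝕜) : f ∈ vanishing 𝕜 c 0 :=
  mem_vanishing.2 fun _ hj => absurd hj (Nat.not_lt_zero _)

theorem mem_vanishing_one {c : ℝ} {f : smoothFun 𝕜} : f ∈ vanishing 𝕜 c 1 ↔ f c = 0 := by
  simp only [mem_vanishing, Nat.lt_one_iff, forall_eq, jet_zero]

theorem mem_vanishing_succ {c : ℝ} {k : ℕ} {f : smoothFun 𝕜} :
    f ∈ vanishing 𝕜 c (k + 1) ↔ f ∈ vanishing 𝕜 c k ∧ jet c k f = 0 := by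
  simp only [mem_vanishing, Nat.forall_lt_succ_right]

theorem mem_vanishing_succ_iff_derivOp {c : ℝ} {k : ℕ} {f : smoothFun 𝕜} :
    f ∈ vanishing 𝕜 c (k + 1) ↔ f c = 0 ∧ derivOp 𝕜 f ∈ vanishing 𝕜 c k := by
  simp only [mem_vanishing, Nat.forall_lt_succ_left, jet_zero, jet_derivOp]

theorem apply_eq_zero_of_mem_vanishing {c : ℝ} {k : ℕ} (hk : k ≠ 0) {f : smoothFun 𝕜}
    (hf : f ∈ vanishing 𝕜 c k) : f c = 0 :=
  mem_vanishing.1 hf 0 (Nat.pos_of_ne_zero hk)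

theorem mul_mem_vanishing {c : ℝ} {k : ℕ} (v : smoothFun 𝕜) {f : smoothFun 𝕜}
    (hf : f ∈ vanishing 𝕜 c k) : v * f ∈ vanishing 𝕜 c k := by
  induction k generalizing v f with
  | zero => exact mem_vanishing_zero c _
  | succ k ih =>
    obtain ⟨hfc, hDf⟩ := mem_vanishing_succ_iff_derivOp.1 hf
    refine mem_vanishing_succ_iff_derivOp.2 ⟨?_, ?_⟩
    · exact mul_eq_zero_of_right (v c) hfc
    · rw [derivOp_mul]
      exact add_mem (ih _ (vanishing_antitone c k.le_succ hf)) (ih _ hDf)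

theorem mem_vanishing_of_mul_mem {c : ℝ} {k : ℕ} {v f : smoothFun 𝕜} (hv : v c ≠ 0)
    (hvf : v * f ∈ vanishing 𝕜 c k) : f ∈ vanishing 𝕜 c k := by
  induction k generalizing f with
  | zero => exact mem_vanishing_zero c _
  | succ k ih =>
    obtain ⟨hvfc, hDvf⟩ := mem_vanishing_succ_iff_derivOp.1 hvf
    have hf : f ∈ vanishing 𝕜 c k := ih (vanishing_antitone c k.le_succ hvf)
    refine mem_vanishing_succ_iff_derivOp.2 ⟨(mul_eq_zero.1 hvfc).resolve_left hv, ih ?_⟩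
    rw [derivOp_mul] at hDvf
    exact ((vanishing 𝕜 c k).add_mem_iff_right (mul_mem_vanishing _ hf)).1 hDvf

theorem aeval_mem_vanishing {P : 𝕜[X]} {c : ℝ} {i k : ℕ} (hik : i + P.natDegree ≤ k)
    {f : smoothFun 𝕜} (hf : f ∈ vanishing 𝕜 c k) :
    aeval (derivOp 𝕜) P f ∈ vanishing 𝕜 c i := by
  refine mem_vanishing.2 fun j hj => ?_
  rw [jet_aeval]
  refine Finset.sum_eq_zero fun l hl => ?_
  have hl' := Finset.mem_range.1 hl
  rw [mem_vanishing.1 hf _ (by omega), mul_zero]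

/-- The kernel of the differential operator `P(d/dx)`. -/
noncomputable def solutions (P : 𝕜[X]) : Submodule 𝕜 (smoothFun 𝕜) :=
  LinearMap.ker (aeval (derivOp 𝕜) P)

theorem mem_solutions {P : 𝕜[X]} {f : smoothFun 𝕜} :
    f ∈ solutions P ↔ aeval (derivOp 𝕜) P f = 0 := Iff.rfl

theorem mem_solutions_mul {P Q : 𝕜[X]} {f : smoothFun 𝕜} :
    f ∈ solutions (P * Q) ↔ aeval (derivOp 𝕜) Q f ∈ solutions P := by
  rw [mem_solutions, aeval_mul_apply, mem_solutions]

end Smooth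

section InitialValueProblem

variable {𝕜 : Type*} [RCLike 𝕜]

theorem exists_jet_eq_dual_of_mem_solutions {P : 𝕜[X]} {f : smoothFun 𝕜} (hf : f ∈ solutions P)
    (hP : P ≠ 0) : ∃ φ : Module.Dual 𝕜 (Fin P.natDegree → 𝕜),
      ∀ x, jet x P.natDegree f = φ fun j => jet x j f := by
  refine ⟨-(P.leadingCoeff⁻¹ • ∑ j : Fin P.natDegree, P.coeff j • LinearMap.proj j),
    fun x => ?_⟩
  have h_eq : jet x 0 (aeval (derivOp 𝕜) P f) = 0 := by rw [mem_solutions.1 hf, map_zero]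
  rw [jet_aeval, Finset.sum_range_succ, Finset.sum_range, coeff_natDegree] at h_eq
  simp only [zero_add] at h_eq
  have h_lead : P.leadingCoeff ≠ 0 := leadingCoeff_ne_zero.2 hP
  simp only [LinearMap.neg_apply, LinearMap.smul_apply, LinearMap.sum_apply, LinearMap.proj_apply,
    smul_eq_mul]
  field_simp
  linear_combination h_eq

theorem eq_zero_of_hasDerivAt_linear {E : Type*} [NormedAddCommGroup E] [NormedSpace ℝ E]
    (A : E →L[ℝ] E) {u : ℝ → E} (hu : ∀ x, HasDerivAt u (A (u x)) x) {x₀ : ℝ} (h₀ : u x₀ = 0) :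
    u = 0 :=
  ODE_solution_unique_univ (v := fun _ => A) (s := fun _ => Set.univ) (K := ‖A‖₊) (t₀ := x₀)
    (fun _ => A.lipschitz.lipschitzOnWith) (fun x => ⟨hu x, Set.mem_univ _⟩)
    (fun x => ⟨by simp, Set.mem_univ _⟩) h₀

theorem eq_zero_of_mem_solutions_of_mem_vanishing {P : 𝕜[X]} (hP : P ≠ 0) {f : smoothFun 𝕜}
    (hf : f ∈ solutions P) {x₀ : ℝ} (h₀ : f ∈ vanishing 𝕜 x₀ P.natDegree) : f = 0 := by
  obtain ⟨φ, hφ⟩ := exists_jet_eq_dual_of_mem_solutions hf hP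
  rcases P.natDegree.eq_zero_or_pos with hd | hd
  · have h_const : P = C (P.coeff 0) := eq_C_of_natDegree_eq_zero hd
    rw [mem_solutions, h_const, aeval_C, Module.algebraMap_end_apply] at hf
    exact (smul_eq_zero.1 hf).resolve_left fun h => hP (by rw [h_const, h, C_0])
  let A : (Fin P.natDegree → 𝕜) →ₗ[𝕜] Fin P.natDegree → 𝕜 := LinearMap.pi fun i =>
    if h : (i : ℕ) + 1 < P.natDegree then LinearMap.proj ⟨i + 1, h⟩ else φ
  have h_deriv (x) : HasDerivAt (fun y (j : Fin P.natDegree) => jet y j f)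
      (A fun j => jet x j f) x := by
    refine hasDerivAt_pi.2 fun i => ?_
    by_cases h : (i : ℕ) + 1 < P.natDegree
    · simp only [A, LinearMap.pi_apply, dif_pos h, LinearMap.proj_apply]
      exact hasDerivAt_jet x i f
    · simpa [A, h, ← hφ, show (i : ℕ) + 1 = P.natDegree by omega] using hasDerivAt_jet x i f
  have h_zero := eq_zero_of_hasDerivAt_linear ((A.restrictScalars ℝ).toContinuousLinearMap)
    h_deriv (x₀ := x₀) (funext fun j => mem_vanishing.1 h₀ j j.2)
  exact Subtype.ext <| funext fun x => congrFun (congrFun h_zero x) ⟨0, hd⟩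

section Exponential

variable {𝔸 : Type*} [NormedRing 𝔸] [NormedAlgebra 𝕜 𝔸] [NormedAlgebra ℝ 𝔸]
  [IsScalarTower ℝ 𝕜 𝔸] [CompleteSpace 𝔸]

/-- The matrix coefficient `x ↦ φ (exp ((x - x₀) T))` of the one-parameter group generated by
`T`; it is a solution of `P(d/dx) f = 0` as soon as `P(T) = 0`. -/
noncomputable def expCoeff (φ : 𝔸 →L[𝕜] 𝕜) (T : 𝔸) (x₀ : ℝ) : smoothFun 𝕜 where
  val x := φ (NormedSpace.exp ((x - x₀) • T))
  property := by
    have h_exp : ContDiff ℝ ∞ (NormedSpace.exp : 𝔸 → 𝔸) :=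
      contDiff_iff_contDiffAt.2 fun T => (NormedSpace.exp_analytic (𝕂 := ℝ) T).contDiffAt
    exact (φ.restrictScalars ℝ).contDiff.comp
      (h_exp.comp ((contDiff_id.sub contDiff_const).smul contDiff_const))

theorem jet_expCoeff (φ : 𝔸 →L[𝕜] 𝕜) (T : 𝔸) (x₀ x : ℝ) (j : ℕ) :
    jet x j (expCoeff φ T x₀) = φ (NormedSpace.exp ((x - x₀) • T) * T ^ j) := by
  induction j generalizing x with
  | zero => rw [pow_zero, mul_one]; rfl
  | succ j ih =>
    have h_exp : HasDerivAt (fun y : ℝ => NormedSpace.exp ((y - x₀) • T))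
        (NormedSpace.exp ((x - x₀) • T) * T) x :=
      (hasDerivAt_exp_smul_const T (x - x₀)).comp_sub_const x x₀
    have h := (φ.restrictScalars ℝ).hasFDerivAt.comp_hasDerivAt x (h_exp.mul_const (T ^ j))
    rw [pow_succ', ← mul_assoc]
    refine (hasDerivAt_jet x j _).unique ?_
    simp only [ih]
    exact h

theorem expCoeff_mem_solutions {P : 𝕜[X]} {T : 𝔸} (hT : aeval T P = 0) (φ : 𝔸 →L[𝕜] 𝕜)
    (x₀ : ℝ) : expCoeff φ T x₀ ∈ solutions P := by
  ext x
  rw [← jet_zero, jet_aeval]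
  simp only [zero_add, jet_expCoeff, ← smul_eq_mul (P.coeff _), ← map_smul, ← map_sum,
    ← mul_smul_comm, ← Finset.mul_sum, ← aeval_eq_sum_range, hT, mul_zero, map_zero]
  rfl

end Exponential

open scoped Matrix.Norms.Operator in
theorem exists_mem_solutions_jet_eq {P : 𝕜[X]} (hP : P ≠ 0) (x₀ : ℝ) (v : Fin P.natDegree → 𝕜) :
    ∃ f ∈ solutions P, ∀ j : Fin P.natDegree, jet x₀ j f = v j := by
  rcases P.natDegree.eq_zero_or_pos with hd | hd
  · exact ⟨0, zero_mem _, fun j => absurd j.2 (by omega)⟩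
  -- Multiplication by the root of `P` on `𝕜[X] / (P)`, in the basis of powers of the root,
  -- satisfies `P(T) = 0`, and `T ^ j` maps the first basis vector to the `j`-th.
  let B := AdjoinRoot.powerBasisAux hP
  have hB (j : Fin P.natDegree) : B j = AdjoinRoot.root P ^ (j : ℕ) :=
    (AdjoinRoot.powerBasis hP).basis_eq_pow j
  let T := Algebra.leftMulMatrix B (AdjoinRoot.root P)
  have hT : aeval T P = 0 := by
    rw [aeval_algHom_apply, AdjoinRoot.aeval_eq, AdjoinRoot.mk_self, map_zero]
  have hT_pow (i j : Fin P.natDegree) : (T ^ (j : ℕ)) i ⟨0, hd⟩ = if j = i then 1 else 0 := by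
    rw [← map_pow, Algebra.leftMulMatrix_eq_repr_mul, hB, pow_zero, mul_one, ← hB,
      Module.Basis.repr_self, Finsupp.single_apply]
  let φ : Matrix (Fin P.natDegree) (Fin P.natDegree) 𝕜 →ₗ[𝕜] 𝕜 :=
    ∑ i, v i • Matrix.entryLinearMap 𝕜 𝕜 i ⟨0, hd⟩
  refine ⟨expCoeff φ.toContinuousLinearMap T x₀, expCoeff_mem_solutions hT _ x₀, fun j => ?_⟩
  calc jet x₀ j (expCoeff φ.toContinuousLinearMap T x₀)
      = φ (NormedSpace.exp ((x₀ - x₀) • T) * T ^ (j : ℕ)) := jet_expCoeff _ T x₀ x₀ j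
    _ = v j := by simp [φ, hT_pow]

/-- A solution of an equation of order `d` corresponds to its first `d` derivatives at `x₀`. -/
noncomputable def jetEquiv {P : 𝕜[X]} (hP : P ≠ 0) (x₀ : ℝ) :
    solutions P ≃ₗ[𝕜] (Fin P.natDegree → 𝕜) :=
  LinearEquiv.ofBijective
    (LinearMap.pi fun j : Fin P.natDegree => jet x₀ j ∘ₗ (solutions P).subtype) <| by
    refine ⟨(injective_iff_map_eq_zero _).2 fun f hf => ?_, fun v => ?_⟩
    · exact Subtype.ext <| eq_zero_of_mem_solutions_of_mem_vanishing hP f.2 <|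
        mem_vanishing.2 fun j hj => congrFun hf ⟨j, hj⟩
    · obtain ⟨f, hf, hfv⟩ := exists_mem_solutions_jet_eq hP x₀ v
      exact ⟨⟨f, hf⟩, funext hfv⟩

theorem jetEquiv_apply {P : 𝕜[X]} (hP : P ≠ 0) (x₀ : ℝ) (f : solutions P)
    (j : Fin P.natDegree) : jetEquiv hP x₀ f j = jet x₀ j (f : smoothFun 𝕜) := rfl

theorem eq_zero_of_solutions_le {P Q : 𝕜[X]} (hP : P ≠ 0) (hPQ : solutions P ≤ solutions Q)
    (hdeg : Q.natDegree < P.natDegree) : Q = 0 := by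
  let f := (jetEquiv hP 0).symm (Pi.single ⟨Q.natDegree, hdeg⟩ 1)
  have h_jet (j) (hj : j < P.natDegree) :
      jet 0 j (f : smoothFun 𝕜) = if j = Q.natDegree then 1 else 0 := by
    rw [← jetEquiv_apply hP 0 f ⟨j, hj⟩, LinearEquiv.apply_symm_apply, Pi.single_apply]
    simp only [Fin.mk.injEq]
  have h_eq : jet 0 0 (aeval (derivOp 𝕜) Q f) = 0 := by
    rw [mem_solutions.1 (hPQ f.2), map_zero]
  rw [jet_aeval, Finset.sum_range_succ, Finset.sum_eq_zero, zero_add, zero_add, h_jet _ hdeg,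
    if_pos rfl, mul_one] at h_eq
  · exact leadingCoeff_eq_zero.1 h_eq
  · intro k hk
    have hk' := Finset.mem_range.1 hk
    rw [zero_add, h_jet k (by omega), if_neg hk'.ne, mul_zero]

end InitialValueProblem

section PostComp

variable {𝕜 𝕜' : Type*} [RCLike 𝕜] [RCLike 𝕜']

/-- Composition of a smooth function with a real-linear map `ℓ` of its values; taken for the real
and imaginary part, for complex conjugation and for the inclusion `ℝ → ℂ`. -/
noncomputable def postComp (ℓ : 𝕜 →L[ℝ] 𝕜') (f : smoothFun 𝕜) : smoothFun 𝕜' :=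
  ⟨fun x => ℓ (f x), ℓ.contDiff.comp (contDiff_smoothFun f)⟩

theorem jet_postComp (ℓ : 𝕜 →L[ℝ] 𝕜') (f : smoothFun 𝕜) (x : ℝ) (j : ℕ) :
    jet x j (postComp ℓ f) = ℓ (jet x j f) := by
  induction j generalizing f with
  | zero => rfl
  | succ j ih =>
    have h_deriv : derivOp 𝕜' (postComp ℓ f) = postComp ℓ (derivOp 𝕜 f) :=
      derivOp_eq_of_hasDerivAt fun x => ℓ.hasFDerivAt.comp_hasDerivAt x (hasDerivAt_smoothFun f x)
    rw [← jet_derivOp, h_deriv, ih, jet_derivOp]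

theorem postComp_mem_vanishing (ℓ : 𝕜 →L[ℝ] 𝕜') {c : ℝ} {k : ℕ} {f : smoothFun 𝕜}
    (hf : f ∈ vanishing 𝕜 c k) : postComp ℓ f ∈ vanishing 𝕜' c k :=
  mem_vanishing.2 fun j hj => by rw [jet_postComp, mem_vanishing.1 hf j hj, map_zero]

theorem postComp_mem_solutions {ℓ : 𝕜 →L[ℝ] 𝕜'} {P : 𝕜[X]} {Q : 𝕜'[X]}
    (hdeg : P.natDegree = Q.natDegree) (hcoeff : ∀ k z, ℓ (P.coeff k * z) = Q.coeff k * ℓ z)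
    {f : smoothFun 𝕜} (hf : f ∈ solutions P) : postComp ℓ f ∈ solutions Q := by
  refine mem_solutions.2 (Subtype.ext <| funext fun x => ?_)
  have hfx : jet x 0 (aeval (derivOp 𝕜) P f) = 0 := by rw [mem_solutions.1 hf, map_zero]
  change jet x 0 (aeval (derivOp 𝕜') Q (postComp ℓ f)) = 0
  rw [← map_zero ℓ, ← hfx]
  simp only [jet_aeval, jet_postComp, map_sum, hcoeff, hdeg]

theorem postComp_mem_solutions_real {ℓ : ℂ →L[ℝ] ℝ} {P : ℝ[X]} {f : smoothFun ℂ}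
    (hf : f ∈ solutions (P.map (algebraMap ℝ ℂ))) : postComp ℓ f ∈ solutions P :=
  postComp_mem_solutions (natDegree_map _)
    (fun k z => by rw [coeff_map, Complex.coe_algebraMap, ← Complex.real_smul, map_smul,
      smul_eq_mul]) hf

end PostComp

section Rolle

/-- Every pair of distinct zeros of `φ` in `s` is separated by a zero of `ψ`. -/
def RolleOn (s : Set ℝ) (φ ψ : ℝ → ℝ) : Prop :=
  ∀ ⦃x⦄, x ∈ s → ∀ ⦃y⦄, y ∈ s → x < y → φ x = 0 → φ y = 0 → ∃ z ∈ Set.Ioo x y, ψ z = 0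

theorem rolleOn_of_hasDerivAt {s : Set ℝ} (hs : s.OrdConnected) {φ ψ v w : ℝ → ℝ}
    (hv : ∀ x ∈ s, v x ≠ 0) (h : ∀ x ∈ s, HasDerivAt (fun y => w y * φ y) (v x * ψ x) x) :
    RolleOn s φ ψ := by
  intro x hx y hy hxy hφx hφy
  have h_sub : Set.Icc x y ⊆ s := hs.out hx hy
  obtain ⟨z, hz, hz'⟩ := exists_hasDerivAt_eq_zero hxy
    (fun z hz => (h z (h_sub hz)).continuousAt.continuousWithinAt)
    (show w x * φ x = w y * φ y by rw [hφx, hφy, mul_zero, mul_zero])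
    fun z hz => h z (h_sub (Set.Ioo_subset_Icc_self hz))
  exact ⟨z, hz, (mul_eq_zero.1 hz').resolve_left (hv z (h_sub (Set.Ioo_subset_Icc_self hz)))⟩

theorem RolleOn.exists_finset {s : Set ℝ} (hs : s.OrdConnected) {φ ψ : ℝ → ℝ}
    (h : RolleOn s φ ψ) {S : Finset ℝ} (hS : ∀ x ∈ S, x ∈ s ∧ φ x = 0) :
    ∃ T : Finset ℝ, (∀ z ∈ T, z ∈ s ∧ ψ z = 0) ∧ Disjoint S T ∧ S.card ≤ T.card + 1 := by
  let Z : Set ℝ := {z | z ∈ s ∧ ψ z = 0 ∧ z ∉ S}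
  rcases Z.finite_or_infinite with hZ | hZ
  · refine ⟨hZ.toFinset, fun z hz => ?_, Finset.disjoint_right.2 fun z hz => ?_,
      Finset.card_le_of_interleaved fun x hx y hy hxy h_between => ?_⟩
    · exact ⟨(hZ.mem_toFinset.1 hz).1, (hZ.mem_toFinset.1 hz).2.1⟩
    · exact (hZ.mem_toFinset.1 hz).2.2
    · obtain ⟨z, hz, hψz⟩ := h (hS x hx).1 (hS y hy).1 hxy (hS x hx).2 (hS y hy).2
      have hzs : z ∈ s := hs.out (hS x hx).1 (hS y hy).1 (Set.Ioo_subset_Icc_self hz)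
      exact ⟨z, hZ.mem_toFinset.2 ⟨hzs, hψz, fun hzS => h_between z hzS hz⟩, hz.1, hz.2⟩
  · obtain ⟨T, hTZ, hT⟩ := hZ.exists_subset_card_eq S.card
    exact ⟨T, fun z hz => ⟨(hTZ hz).1, (hTZ hz).2.1⟩,
      Finset.disjoint_right.2 fun z hz => (hTZ hz).2.2, by omega⟩

/-- `g` has at least `N` zeros in `s`, counted with multiplicity. -/
def HasZeros (s : Set ℝ) (N : ℕ) (g : smoothFun ℝ) : Prop :=
  ∃ (S : Finset ℝ) (m : ℝ → ℕ),
    (∀ x ∈ S, x ∈ s ∧ g ∈ vanishing ℝ x (m x)) ∧ N ≤ ∑ x ∈ S, m x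

theorem HasZeros.mono {s t : Set ℝ} {M N : ℕ} {g : smoothFun ℝ} (h : HasZeros s N g)
    (hst : s ⊆ t) (hMN : M ≤ N) : HasZeros t M g :=
  let ⟨S, m, hS, hN⟩ := h
  ⟨S, m, fun x hx => ⟨hst (hS x hx).1, (hS x hx).2⟩, hMN.trans hN⟩

theorem hasZeros_zero (s : Set ℝ) (g : smoothFun ℝ) : HasZeros s 0 g :=
  ⟨∅, 0, fun _ hx => absurd hx (Finset.notMem_empty _), Nat.zero_le _⟩

theorem HasZeros.insert {s : Set ℝ} {N : ℕ} {g : smoothFun ℝ} (h : HasZeros s N g) {c : ℝ}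
    (hc : c ∉ s) {k : ℕ} (hg : g ∈ vanishing ℝ c k) : HasZeros (insert c s) (k + N) g := by
  obtain ⟨S, m, hS, hN⟩ := h
  have hcS : c ∉ S := fun hcS => hc (hS c hcS).1
  refine ⟨Insert.insert c S, Function.update m c k, fun x hx => ?_, ?_⟩
  · rcases Finset.mem_insert.1 hx with rfl | hxS
    · exact ⟨Set.mem_insert x s, by rwa [Function.update_self]⟩
    · rw [Function.update_of_ne (ne_of_mem_of_not_mem hxS hcS)]
      exact ⟨Set.mem_insert_of_mem c (hS x hxS).1, (hS x hxS).2⟩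
  · rw [Finset.sum_insert hcS, Function.update_self, Finset.sum_update_of_notMem hcS]
    omega

theorem HasZeros.rolle {s : Set ℝ} (hs : s.OrdConnected) {N : ℕ} {g h : smoothFun ℝ}
    (hgh : RolleOn s g h)
    (h_order : ∀ x ∈ s, ∀ k, g ∈ vanishing ℝ x (k + 1) → h ∈ vanishing ℝ x k)
    (hg : HasZeros s (N + 1) g) : HasZeros s N h := by
  classical
  obtain ⟨S, m, hS, hN⟩ := hg
  let S' := S.filter (m · ≠ 0)
  have hS' (x) (hx : x ∈ S') : x ∈ s ∧ g x = 0 :=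
    ⟨(hS x (Finset.mem_filter.1 hx).1).1, apply_eq_zero_of_mem_vanishing (Finset.mem_filter.1 hx).2
      (hS x (Finset.mem_filter.1 hx).1).2⟩
  obtain ⟨T, hT, h_disj, h_card⟩ := hgh.exists_finset hs hS'
  refine ⟨S' ∪ T, fun x => if x ∈ S' then m x - 1 else 1, fun x hx => ?_, ?_⟩
  · beta_reduce
    by_cases hxS : x ∈ S'
    · rw [if_pos hxS]
      obtain ⟨hx_mem, hmx⟩ := Finset.mem_filter.1 hxS
      refine ⟨(hS x hx_mem).1, h_order x (hS x hx_mem).1 _ ?_⟩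
      rw [Nat.sub_add_cancel (Nat.pos_of_ne_zero hmx)]
      exact (hS x hx_mem).2
    · rw [if_neg hxS, mem_vanishing_one]
      exact hT x ((Finset.mem_union.1 hx).resolve_left hxS)
  · have h_sum : ∑ x ∈ S, m x = ∑ x ∈ S', (m x - 1) + S'.card := by
      rw [← Finset.sum_filter_ne_zero, Finset.card_eq_sum_ones, ← Finset.sum_add_distrib]
      exact Finset.sum_congr rfl fun x hx =>
        (Nat.sub_add_cancel (Nat.pos_of_ne_zero (Finset.mem_filter.1 hx).2)).symm
    rw [Finset.sum_union h_disj, Finset.sum_congr rfl fun x hx => if_pos hx,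
      Finset.sum_congr rfl fun x hx => if_neg (Finset.disjoint_right.1 h_disj hx),
      ← Finset.card_eq_sum_ones]
    omega

theorem HasZeros.exists_apply_eq_zero {s : Set ℝ} {N : ℕ} {g : smoothFun ℝ}
    (h : HasZeros s N g) (hN : N ≠ 0) : ∃ x ∈ s, g x = 0 := by
  obtain ⟨S, m, hS, hNm⟩ := h
  obtain ⟨x, hx, hmx⟩ := Finset.exists_ne_zero_of_sum_ne_zero (by omega : ∑ x ∈ S, m x ≠ 0)
  exact ⟨x, (hS x hx).1, apply_eq_zero_of_mem_vanishing hmx (hS x hx).2⟩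

end Rolle

section Disconjugate

/-- `P(d/dx)` is disconjugate on `[a, b]`: a nontrivial solution of `P(d/dx) g = 0` has fewer
than `deg P` zeros in `[a, b]`, counted with multiplicity. In particular, `P ≠ 0`. -/
def Disconjugate (P : ℝ[X]) (a b : ℝ) : Prop :=
  ∀ g ∈ solutions P, HasZeros (Set.Icc a b) P.natDegree g → g = 0

variable {a b : ℝ}

theorem disconjugate_C {c : ℝ} (hc : c ≠ 0) : Disconjugate (C c) a b := fun g hg _ => by
  rw [mem_solutions, aeval_C, Module.algebraMap_end_apply] at hg
  exact (smul_eq_zero.1 hg).resolve_left hc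

theorem Disconjugate.ne_zero {P : ℝ[X]} (hP : Disconjugate P a b) : P ≠ 0 := by
  rintro rfl
  refine one_ne_zero (hP 1 ?_ (hasZeros_zero _ _))
  rw [mem_solutions, map_zero, LinearMap.zero_apply]

theorem Disconjugate.mul {L Q : ℝ[X]} (hL : Disconjugate L a b) (hQ : Disconjugate Q a b)
    (h_rolle : ∀ N g, HasZeros (Set.Icc a b) (N + L.natDegree) g →
      HasZeros (Set.Icc a b) N (aeval (derivOp ℝ) L g)) :
    Disconjugate (L * Q) a b := by
  intro g hg hz
  rw [natDegree_mul hL.ne_zero hQ.ne_zero, add_comm] at hz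
  rw [mul_comm, mem_solutions_mul] at hg
  exact hL g (hQ _ hg (h_rolle _ g hz)) (hz.mono subset_rfl (Nat.le_add_left _ _))

theorem hasDerivAt_exp_mul (c x : ℝ) :
    HasDerivAt (fun y => Real.exp (c * y)) (c * Real.exp (c * x)) x := by
  simpa [mul_comm] using ((hasDerivAt_id x).const_mul c).exp

theorem hasZeros_aeval_X_sub_C {c : ℝ} {N : ℕ} {g : smoothFun ℝ}
    (hg : HasZeros (Set.Icc a b) (N + 1) g) :
    HasZeros (Set.Icc a b) N (aeval (derivOp ℝ) (X - C c) g) := by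
  refine hg.rolle Set.ordConnected_Icc (rolleOn_of_hasDerivAt Set.ordConnected_Icc
    (v := fun x => Real.exp (-c * x)) (w := fun x => Real.exp (-c * x))
    (fun x _ => Real.exp_ne_zero _) fun x _ => ?_) fun x _ k hk => ?_
  · refine ((hasDerivAt_exp_mul (-c) x).mul (hasDerivAt_smoothFun g x)).congr_deriv ?_
    rw [aeval_X_sub_C_apply]
    change _ = Real.exp (-c * x) * (derivOp ℝ g x - c * g x)
    ring
  · exact aeval_mem_vanishing (by rw [natDegree_X_sub_C]) hk

theorem disconjugate_X_sub_C (c : ℝ) : Disconjugate (X - C c) a b := fun g hg hz => by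
  rw [natDegree_X_sub_C] at hz
  obtain ⟨x, -, hx⟩ := hz.exists_apply_eq_zero one_ne_zero
  refine eq_zero_of_mem_solutions_of_mem_vanishing (X_sub_C_ne_zero c) hg (x₀ := x) ?_
  rw [natDegree_X_sub_C, mem_vanishing_one, hx]

theorem Disconjugate.X_sub_C_mul {Q : ℝ[X]} (hQ : Disconjugate Q a b) (c : ℝ) :
    Disconjugate ((X - C c) * Q) a b :=
  (disconjugate_X_sub_C c).mul hQ fun N g hg =>
    hasZeros_aeval_X_sub_C (by rwa [natDegree_X_sub_C] at hg)

section Quadratic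

variable (α β m : ℝ)

/-- The function `e^{-αx} cos β(x - m)`. -/
noncomputable def dampedCos : smoothFun ℝ :=
  ⟨fun x => Real.exp (-α * x) * Real.cos (β * (x - m)),
    show ContDiff ℝ ∞ fun x => Real.exp (-α * x) * Real.cos (β * (x - m)) by fun_prop⟩

/-- The function `e^{-αx} sin β(x - m)`. -/
noncomputable def dampedSin : smoothFun ℝ :=
  ⟨fun x => Real.exp (-α * x) * Real.sin (β * (x - m)),
    show ContDiff ℝ ∞ fun x => Real.exp (-α * x) * Real.sin (β * (x - m)) by fun_prop⟩

theorem hasDerivAt_mul_sub (x : ℝ) : HasDerivAt (fun y => β * (y - m)) β x := by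
  simpa using ((hasDerivAt_id x).sub_const m).const_mul β

theorem derivOp_dampedCos :
    derivOp ℝ (dampedCos α β m) = -α • dampedCos α β m - β • dampedSin α β m :=
  derivOp_eq_of_hasDerivAt fun x => by
    refine ((hasDerivAt_exp_mul (-α) x).mul (hasDerivAt_mul_sub β m x).cos).congr_deriv ?_
    change _ = -α * (_ * _) - β * (_ * _)
    ring

theorem derivOp_dampedSin :
    derivOp ℝ (dampedSin α β m) = -α • dampedSin α β m + β • dampedCos α β m :=
  derivOp_eq_of_hasDerivAt fun x => by
    refine ((hasDerivAt_exp_mul (-α) x).mul (hasDerivAt_mul_sub β m x).sin).congr_deriv ?_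
    change _ = -α * (_ * _) + β * (_ * _)
    ring

/-- The Wronskian of `e^{αx} cos β(x - m)` and `g`, multiplied by `e^{-2αx}`. It splits the
quadratic operator with roots `α ± iβ` into two steps, each of which obeys a Rolle theorem where
the cosine has no zero. -/
noncomputable def cosWronskian (g : smoothFun ℝ) : smoothFun ℝ :=
  dampedCos α β m * (derivOp ℝ g - α • g) + β • (dampedSin α β m * g)

theorem derivOp_cosWronskian (g : smoothFun ℝ) :
    derivOp ℝ (cosWronskian α β m g) =
      dampedCos α β m * aeval (derivOp ℝ) ((X - C α) ^ 2 + C (β ^ 2)) g := by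
  rw [cosWronskian, map_add, map_smul, derivOp_mul, derivOp_mul, derivOp_dampedCos,
    derivOp_dampedSin, map_add, LinearMap.add_apply, sq (X - C α), aeval_mul_apply, aeval_C,
    Module.algebraMap_end_apply, aeval_X_sub_C_apply, aeval_X_sub_C_apply, map_sub, map_smul]
  simp only [Algebra.smul_def, map_pow, map_neg]
  ring

variable {α β m}

theorem rolleOn_cosWronskian {s : Set ℝ} (hs : s.OrdConnected)
    (hcos : ∀ x ∈ s, Real.cos (β * (x - m)) ≠ 0) (g : smoothFun ℝ) :
    RolleOn s g (cosWronskian α β m g) := by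
  refine rolleOn_of_hasDerivAt hs (v := fun x => (Real.cos (β * (x - m)) ^ 2)⁻¹)
    (w := fun x => Real.exp (-α * x) / Real.cos (β * (x - m)))
    (fun x hx => inv_ne_zero (pow_ne_zero 2 (hcos x hx))) fun x hx => ?_
  refine (((hasDerivAt_exp_mul (-α) x).div (hasDerivAt_mul_sub β m x).cos (hcos x hx)).mul
    (hasDerivAt_smoothFun g x)).congr_deriv ?_
  change _ = _ * (Real.exp (-α * x) * Real.cos (β * (x - m)) * (derivOp ℝ g x - α * g x) +
    β * (Real.exp (-α * x) * Real.sin (β * (x - m)) * g x))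
  have hcos_x := hcos x hx
  rw [Pi.div_apply]
  field_simp
  ring

theorem cosWronskian_mem_vanishing {c : ℝ} {k : ℕ} {g : smoothFun ℝ}
    (hg : g ∈ vanishing ℝ c (k + 1)) : cosWronskian α β m g ∈ vanishing ℝ c k := by
  have hg' : g ∈ vanishing ℝ c k := vanishing_antitone c k.le_succ hg
  exact add_mem
    (mul_mem_vanishing _
      (sub_mem (mem_vanishing_succ_iff_derivOp.1 hg).2 (Submodule.smul_mem _ α hg')))
    (Submodule.smul_mem _ β (mul_mem_vanishing _ hg'))

theorem hasZeros_aeval_quadratic (hcos : ∀ x ∈ Set.Icc a b, Real.cos (β * (x - m)) ≠ 0) {N : ℕ}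
    {g : smoothFun ℝ} (hg : HasZeros (Set.Icc a b) (N + 2) g) :
    HasZeros (Set.Icc a b) N (aeval (derivOp ℝ) ((X - C α) ^ 2 + C (β ^ 2)) g) := by
  have h_damped (x) (hx : x ∈ Set.Icc a b) : dampedCos α β m x ≠ 0 :=
    mul_ne_zero (Real.exp_ne_zero _) (hcos x hx)
  have hW : HasZeros (Set.Icc a b) (N + 1) (cosWronskian α β m g) :=
    hg.rolle Set.ordConnected_Icc (rolleOn_cosWronskian Set.ordConnected_Icc hcos g)
      fun x _ k hk => cosWronskian_mem_vanishing hk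
  refine hW.rolle Set.ordConnected_Icc (rolleOn_of_hasDerivAt Set.ordConnected_Icc
    (v := dampedCos α β m) (w := 1) h_damped fun x _ => ?_) fun x hx k hk => ?_
  · simp only [Pi.one_apply, one_mul]
    refine (hasDerivAt_smoothFun (cosWronskian α β m g) x).congr_deriv ?_
    rw [derivOp_cosWronskian]
    rfl
  · refine mem_vanishing_of_mul_mem (h_damped x hx) ?_
    rw [← derivOp_cosWronskian]
    exact (mem_vanishing_succ_iff_derivOp.1 hk).2

theorem natDegree_quadratic : ((X - C α) ^ 2 + C (β ^ 2)).natDegree = 2 := by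
  rw [natDegree_add_C, natDegree_pow, natDegree_X_sub_C]

theorem disconjugate_quadratic (hcos : ∀ x ∈ Set.Icc a b, Real.cos (β * (x - m)) ≠ 0) :
    Disconjugate ((X - C α) ^ 2 + C (β ^ 2)) a b := by
  intro g hg hz
  rw [natDegree_quadratic] at hz
  have h_ne : (X - C α) ^ 2 + C (β ^ 2) ≠ 0 := ne_zero_of_natDegree_gt (n := 1) (by
    rw [natDegree_quadratic]; exact one_lt_two)
  obtain ⟨x, -, hx⟩ := HasZeros.exists_apply_eq_zero (hz.rolle Set.ordConnected_Icc
    (rolleOn_cosWronskian Set.ordConnected_Icc hcos g)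
      fun x _ k hk => cosWronskian_mem_vanishing hk) one_ne_zero
  have hW : cosWronskian α β m g = 0 := by
    refine eq_zero_of_mem_solutions_of_mem_vanishing X_ne_zero ?_ (x₀ := x) ?_
    · rw [mem_solutions, aeval_X, derivOp_cosWronskian, mem_solutions.1 hg, mul_zero]
    · rwa [natDegree_X, mem_vanishing_one]
  obtain ⟨y, hy, hgy⟩ := hz.exists_apply_eq_zero two_ne_zero
  refine eq_zero_of_mem_solutions_of_mem_vanishing h_ne hg (x₀ := y) ?_
  rw [natDegree_quadratic, mem_vanishing_succ_iff_derivOp, mem_vanishing_one]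
  refine ⟨hgy, ?_⟩
  have hWy : dampedCos α β m y * (derivOp ℝ g y - α * g y) + β * (dampedSin α β m y * g y) = 0 :=
    congrFun (congrArg Subtype.val hW) y
  rw [hgy, mul_zero, mul_zero, mul_zero, add_zero, sub_zero] at hWy
  exact (mul_eq_zero.1 hWy).resolve_left (mul_ne_zero (Real.exp_ne_zero _) (hcos y hy))

end Quadratic

theorem cos_mul_sub_midpoint_ne_zero {β x : ℝ} (hβ : |β| * (b - a) < Real.pi)
    (hx : x ∈ Set.Icc a b) : Real.cos (β * (x - (a + b) / 2)) ≠ 0 := by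
  have h_dist : |x - (a + b) / 2| ≤ (b - a) / 2 := abs_le.2 ⟨by linarith [hx.1], by linarith [hx.2]⟩
  have h_lt : |β * (x - (a + b) / 2)| < Real.pi / 2 := by
    rw [abs_mul]
    linarith [mul_le_mul_of_nonneg_left h_dist (abs_nonneg β)]
  exact (Real.cos_pos_of_mem_Ioo (abs_lt.1 h_lt)).ne'

theorem X_sub_C_dvd_of_aeval_eq_zero {P : ℝ[X]} {z : ℂ} (hz : aeval z P = 0) (him : z.im = 0) :
    X - C z.re ∣ P := by
  have hz_re : z = algebraMap ℝ ℂ z.re := Complex.ext rfl (by simp [him])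
  rw [hz_re, aeval_algebraMap_apply] at hz
  exact dvd_iff_isRoot.2 (by simpa using hz)

theorem quadratic_dvd_of_aeval_eq_zero {P : ℝ[X]} {z : ℂ} (hz : aeval z P = 0)
    (him : z.im ≠ 0) : (X - C z.re) ^ 2 + C (z.im ^ 2) ∣ P := by
  have h_quadratic : X ^ 2 - C (2 * z.re) * X + C (‖z‖ ^ 2) =
      (X - C z.re) ^ 2 + C (z.im ^ 2) := by
    rw [← Complex.normSq_eq_norm_sq, Complex.normSq_apply]
    simp only [map_mul, map_add, map_pow, map_ofNat]
    ring
  exact h_quadratic ▸ quadratic_dvd_of_aeval_eq_zero_im_ne_zero P hz him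

theorem disconjugate_of_forall_abs_im_lt {P : ℝ[X]} (hP : P ≠ 0)
    (h_roots : ∀ z : ℂ, aeval z P = 0 → |z.im| * (b - a) < Real.pi) : Disconjugate P a b := by
  induction hd : P.natDegree using Nat.strong_induction_on generalizing P with
  | _ d ih =>
    have h_factor {L Q : ℝ[X]} (hPQ : P = L * Q) (hL : L.natDegree ≠ 0) : Disconjugate Q a b := by
      obtain ⟨hL₀, hQ₀⟩ := mul_ne_zero_iff.1 (hPQ ▸ hP)
      refine ih _ ?_ hQ₀ (fun z hz => h_roots z (by rw [hPQ, map_mul, hz, mul_zero])) rfl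
      rw [← hd, hPQ, natDegree_mul hL₀ hQ₀]
      omega
    by_cases hd₀ : P.natDegree = 0
    · rw [eq_C_of_natDegree_eq_zero hd₀] at hP ⊢
      exact disconjugate_C (C_ne_zero.1 hP)
    obtain ⟨z, hz⟩ := IsAlgClosed.exists_aeval_eq_zero ℂ P
      (fun h => hd₀ (natDegree_eq_zero_iff_degree_le_zero.2 h.le))
    by_cases him : z.im = 0
    · obtain ⟨Q, hPQ⟩ := X_sub_C_dvd_of_aeval_eq_zero hz him
      rw [hPQ]
      exact (h_factor hPQ (by rw [natDegree_X_sub_C]; exact one_ne_zero)).X_sub_C_mul z.re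
    · obtain ⟨Q, hPQ⟩ := quadratic_dvd_of_aeval_eq_zero hz him
      have hcos (x) (hx : x ∈ Set.Icc a b) := cos_mul_sub_midpoint_ne_zero (h_roots z hz) hx
      rw [hPQ]
      refine (disconjugate_quadratic hcos).mul (h_factor hPQ ?_) fun N g hg =>
        hasZeros_aeval_quadratic hcos (by rwa [natDegree_quadratic] at hg)
      rw [natDegree_quadratic]
      exact two_ne_zero

end Disconjugate

section Bernstein

variable {P : ℝ[X]} {a b : ℝ}

theorem Disconjugate.eq_zero_of_mem_vanishing (hP : Disconjugate P a b) (hab : a < b) {i j : ℕ}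
    (hij : P.natDegree ≤ i + j) {g : smoothFun ℝ} (hg : g ∈ solutions P)
    (ha : g ∈ vanishing ℝ a i) (hb : g ∈ vanishing ℝ b j) : g = 0 := by
  have hz := ((hasZeros_zero ∅ g).insert (Set.notMem_empty b) hb).insert
    (by simpa using hab.ne) ha
  refine hP g hg (hz.mono (fun x hx => ?_) (by omega))
  rcases hx with rfl | rfl | hx
  · exact Set.left_mem_Icc.2 hab.le
  · exact Set.right_mem_Icc.2 hab.le
  · exact absurd hx (Set.notMem_empty x)

theorem Disconjugate.apply_ne_zero (hP : Disconjugate P a b) {i j : ℕ}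
    (hij : P.natDegree ≤ i + j + 1) {g : smoothFun ℝ} (hg : g ∈ solutions P) (hg₀ : g ≠ 0)
    (ha : g ∈ vanishing ℝ a i) (hb : g ∈ vanishing ℝ b j) {x : ℝ} (hx : x ∈ Set.Ioo a b) :
    g x ≠ 0 := fun hgx => by
  have hz := (((hasZeros_zero ∅ g).insert (Set.notMem_empty b) hb).insert
    (by simpa using (hx.1.trans hx.2).ne) ha).insert
    (by simp [hx.1.ne', hx.2.ne]) (mem_vanishing_one.2 hgx)
  refine hg₀ (hP g hg (hz.mono (fun y hy => ?_) (by omega)))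
  rcases hy with rfl | rfl | rfl | hy
  · exact Set.Ioo_subset_Icc_self hx
  · exact Set.left_mem_Icc.2 (hx.1.trans hx.2).le
  · exact Set.right_mem_Icc.2 (hx.1.trans hx.2).le
  · exact absurd hy (Set.notMem_empty y)

theorem exists_ne_zero_mem_vanishing (hP : P ≠ 0) (a b : ℝ) {i j : ℕ}
    (hij : i + j < P.natDegree) :
    ∃ g ∈ solutions P, g ≠ 0 ∧ g ∈ vanishing ℝ a i ∧ g ∈ vanishing ℝ b j := by
  let conditions : (Fin P.natDegree → ℝ) →ₗ[ℝ] Fin i ⊕ Fin j → ℝ :=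
    LinearMap.pi (Sum.elim (fun l => jet a l) fun l => jet b l) ∘ₗ (solutions P).subtype ∘ₗ
      (jetEquiv hP a).symm.toLinearMap
  have h_ker : LinearMap.ker conditions ≠ ⊥ :=
    LinearMap.ker_ne_bot_of_finrank_lt (by simpa using hij)
  obtain ⟨v, hv, hv₀⟩ := Submodule.exists_mem_ne_zero_of_ne_bot h_ker
  refine ⟨(jetEquiv hP a).symm v, Subtype.property _, fun h => hv₀ ?_,
    mem_vanishing.2 fun l hl => congrFun hv (Sum.inl ⟨l, hl⟩),
    mem_vanishing.2 fun l hl => congrFun hv (Sum.inr ⟨l, hl⟩)⟩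
  exact (jetEquiv hP a).symm.map_eq_zero_iff.1 (Subtype.ext h)

/-- `u` is the normalized Bernstein function with index `k` of `P(d/dx) u = 0` with respect to
`a`, `b`. The zeros at `a` and `b` have order at least `k` and `deg P - 1 - k`; they have exactly
these orders if `P` is disconjugate on `[a, b]`. -/
structure IsBernsteinFun (P : ℝ[X]) (a b : ℝ) (k : ℕ) (u : smoothFun ℝ) : Prop where
  mem_solutions : u ∈ solutions P
  mem_vanishing_left : u ∈ vanishing ℝ a k
  mem_vanishing_right : u ∈ vanishing ℝ b (P.natDegree - 1 - k)
  jet_left : jet a k u = 1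

theorem Disconjugate.exists_isBernsteinFun (hP : Disconjugate P a b) (hab : a < b) {k : ℕ}
    (hk : k < P.natDegree) : ∃ u, IsBernsteinFun P a b k u := by
  obtain ⟨g, hg, hg₀, ha, hb⟩ := exists_ne_zero_mem_vanishing hP.ne_zero a b
    (show k + (P.natDegree - 1 - k) < P.natDegree by omega)
  have h_jet : jet a k g ≠ 0 := fun h => hg₀ <|
    hP.eq_zero_of_mem_vanishing hab (by omega) hg (mem_vanishing_succ.2 ⟨ha, h⟩) hb
  exact ⟨(jet a k g)⁻¹ • g, Submodule.smul_mem _ _ hg, Submodule.smul_mem _ _ ha,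
    Submodule.smul_mem _ _ hb, by rw [map_smul, smul_eq_mul, inv_mul_cancel₀ h_jet]⟩

open Classical in
/-- The `k`-th Bernstein function of `P(d/dx) u = 0` with respect to `a`, `b`, or `0` if there is
none, as for `k ≥ deg P` and `P` disconjugate. -/
noncomputable def bernstein (P : ℝ[X]) (a b : ℝ) (k : ℕ) : smoothFun ℝ :=
  if h : ∃ u, IsBernsteinFun P a b k u then h.choose else 0

theorem bernstein_mem_solutions (P : ℝ[X]) (a b : ℝ) (k : ℕ) : bernstein P a b k ∈ solutions P := by
  rw [bernstein]
  split_ifs with h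
  exacts [h.choose_spec.mem_solutions, zero_mem _]

theorem bernstein_mem_vanishing_left (P : ℝ[X]) (a b : ℝ) (k : ℕ) :
    bernstein P a b k ∈ vanishing ℝ a k := by
  rw [bernstein]
  split_ifs with h
  exacts [h.choose_spec.mem_vanishing_left, zero_mem _]

theorem bernstein_mem_vanishing_right (P : ℝ[X]) (a b : ℝ) (k : ℕ) :
    bernstein P a b k ∈ vanishing ℝ b (P.natDegree - 1 - k) := by
  rw [bernstein]
  split_ifs with h
  exacts [h.choose_spec.mem_vanishing_right, zero_mem _]

section

variable (hP : Disconjugate P a b) (hab : a < b)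

include hP hab

theorem Disconjugate.jet_bernstein_left {k : ℕ} (hk : k < P.natDegree) :
    jet a k (bernstein P a b k) = 1 := by
  rw [bernstein, dif_pos (hP.exists_isBernsteinFun hab hk)]
  exact (hP.exists_isBernsteinFun hab hk).choose_spec.jet_left

theorem Disconjugate.eq_smul_bernstein {k : ℕ} {g : smoothFun ℝ} (hg : g ∈ solutions P)
    (ha : g ∈ vanishing ℝ a k) (hb : g ∈ vanishing ℝ b (P.natDegree - 1 - k)) :
    g = jet a k g • bernstein P a b k := by
  by_cases hk : k < P.natDegree
  · refine sub_eq_zero.1 (hP.eq_zero_of_mem_vanishing hab (i := k + 1) (by omega)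
      (sub_mem hg (Submodule.smul_mem _ _ (bernstein_mem_solutions P a b k)))
      (mem_vanishing_succ.2
        ⟨sub_mem ha (Submodule.smul_mem _ _ (bernstein_mem_vanishing_left P a b k)), ?_⟩)
      (sub_mem hb (Submodule.smul_mem _ _ (bernstein_mem_vanishing_right P a b k))))
    rw [map_sub, map_smul, hP.jet_bernstein_left hab hk, smul_eq_mul, mul_one, sub_self]
  · have hg₀ : g = 0 := hP.eq_zero_of_mem_vanishing hab (by omega) hg ha hb
    rw [hg₀, map_zero, zero_smul]

theorem Disconjugate.bernstein_ne_zero {k : ℕ} (hk : k < P.natDegree) :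
    bernstein P a b k ≠ 0 := fun h => by
  simpa [h] using hP.jet_bernstein_left hab hk

theorem Disconjugate.jet_bernstein_right_ne_zero {k : ℕ} (hk : k < P.natDegree) :
    jet b (P.natDegree - 1 - k) (bernstein P a b k) ≠ 0 := fun h =>
  hP.bernstein_ne_zero hab hk <| hP.eq_zero_of_mem_vanishing hab (i := k) (by omega)
    (bernstein_mem_solutions P a b k) (bernstein_mem_vanishing_left P a b k)
    (mem_vanishing_succ.2 ⟨bernstein_mem_vanishing_right P a b k, h⟩)

theorem Disconjugate.bernstein_eq_zero {k : ℕ} (hk : P.natDegree ≤ k) : bernstein P a b k = 0 :=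
  hP.eq_zero_of_mem_vanishing hab (Nat.le_add_right_of_le hk) (bernstein_mem_solutions P a b k)
    (bernstein_mem_vanishing_left P a b k) (mem_vanishing_zero b _)

end

open Filter Topology in
theorem eventually_pos_of_jet_pos {c : ℝ} {k : ℕ} {f : smoothFun ℝ} (hf : f ∈ vanishing ℝ c k)
    (h_jet : 0 < jet c k f) : ∀ᶠ x in 𝓝[>] c, 0 < f x := by
  induction k generalizing f with
  | zero =>
    exact ((contDiff_smoothFun f).continuous.continuousAt.eventually_const_lt h_jet).filter_mono
      nhdsWithin_le_nhds
  | succ k ih =>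
    obtain ⟨hfc, hDf⟩ := mem_vanishing_succ_iff_derivOp.1 hf
    obtain ⟨d, hd, h_sub⟩ := mem_nhdsGT_iff_exists_Ioo_subset.1
      (ih hDf (by rwa [jet_derivOp]))
    refine mem_nhdsGT_iff_exists_Ioo_subset.2 ⟨d, hd, fun x hx => ?_⟩
    have h_mono : StrictMonoOn f (Set.Ico c d) :=
      strictMonoOn_of_deriv_pos (convex_Ico c d) (contDiff_smoothFun f).continuous.continuousOn
        (by rw [interior_Ico]; exact fun y hy => h_sub hy)
    exact hfc.symm.trans_lt
      (h_mono (Set.left_mem_Ico.2 hd) (Set.Ioo_subset_Ico_self hx) hx.1)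

theorem Disconjugate.bernstein_pos (hP : Disconjugate P a b) {k : ℕ} (hk : k < P.natDegree)
    {x : ℝ} (hx : x ∈ Set.Ioo a b) : 0 < bernstein P a b k x := by
  have hab : a < b := hx.1.trans hx.2
  have h_ne (y) (hy : y ∈ Set.Ioo a b) : bernstein P a b k y ≠ 0 :=
    hP.apply_ne_zero (by omega) (bernstein_mem_solutions P a b k) (hP.bernstein_ne_zero hab hk)
      (bernstein_mem_vanishing_left P a b k) (bernstein_mem_vanishing_right P a b k) hy
  have h_near : ∀ᶠ y in nhdsWithin a (Set.Ioi a), 0 < bernstein P a b k y :=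
    eventually_pos_of_jet_pos (bernstein_mem_vanishing_left P a b k)
      (by rw [hP.jet_bernstein_left hab hk]; exact one_pos)
  obtain ⟨y, hy_pos, hy⟩ := (h_near.and (Ioo_mem_nhdsGT hab)).exists
  by_contra! hx_neg
  obtain ⟨z, hz, hz₀⟩ := isPreconnected_Ioo.intermediate_value hx hy
    (contDiff_smoothFun (bernstein P a b k)).continuous.continuousOn ⟨hx_neg, hy_pos.le⟩
  exact h_ne z hz hz₀

end Bernstein

section BernsteinSum

variable {P : ℝ[X]} {a b : ℝ}

/-- The Bernstein polynomial `∑ c k • p k` with coefficients `c`, in terms of the Bernstein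
functions of `P`. -/
noncomputable def bernsteinSum (P : ℝ[X]) (a b : ℝ) (c : ℕ → ℝ) : smoothFun ℝ :=
  ∑ k ∈ Finset.range P.natDegree, c k • bernstein P a b k

theorem bernsteinSum_congr {c d : ℕ → ℝ} (h : ∀ k < P.natDegree, c k = d k) :
    bernsteinSum P a b c = bernsteinSum P a b d :=
  Finset.sum_congr rfl fun k hk => by rw [h k (Finset.mem_range.1 hk)]

theorem bernsteinSum_zero : bernsteinSum P a b 0 = 0 := by
  simp only [bernsteinSum, Pi.zero_apply, zero_smul, Finset.sum_const_zero]

theorem bernsteinSum_sub (c d : ℕ → ℝ) :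
    bernsteinSum P a b (c - d) = bernsteinSum P a b c - bernsteinSum P a b d := by
  simp only [bernsteinSum, Pi.sub_apply, sub_smul, Finset.sum_sub_distrib]

theorem jet_bernsteinSum (c : ℕ → ℝ) (x : ℝ) (j : ℕ) :
    jet x j (bernsteinSum P a b c) =
      ∑ k ∈ Finset.range P.natDegree, c k * jet x j (bernstein P a b k) := by
  simp only [bernsteinSum, map_sum, map_smul, smul_eq_mul]

theorem bernsteinSum_apply (c : ℕ → ℝ) (x : ℝ) :
    bernsteinSum P a b c x = ∑ k ∈ Finset.range P.natDegree, c k * bernstein P a b k x :=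
  jet_bernsteinSum c x 0

theorem bernsteinSum_mem_solutions (c : ℕ → ℝ) : bernsteinSum P a b c ∈ solutions P :=
  sum_mem fun k _ => Submodule.smul_mem _ _ (bernstein_mem_solutions P a b k)

theorem bernsteinSum_apply_right {n : ℕ} (hn : P.natDegree = n + 1) (c : ℕ → ℝ) :
    bernsteinSum P a b c b = c n * bernstein P a b n b := by
  rw [bernsteinSum_apply, hn, Finset.sum_range_succ, Finset.sum_eq_zero fun k hk => ?_, zero_add]
  have hkn := Finset.mem_range.1 hk
  rw [apply_eq_zero_of_mem_vanishing (by omega) (bernstein_mem_vanishing_right P a b k), mul_zero]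

theorem Disconjugate.jet_bernsteinSum_left (hP : Disconjugate P a b) (hab : a < b) {c : ℕ → ℝ}
    {k : ℕ} (hk : k < P.natDegree) (hc : ∀ j < k, c j = 0) :
    jet a k (bernsteinSum P a b c) = c k := by
  rw [jet_bernsteinSum, Finset.sum_eq_single k, hP.jet_bernstein_left hab hk, mul_one]
  · intro j _ hjk
    rcases hjk.lt_or_gt with h | h
    · rw [hc j h, zero_mul]
    · rw [mem_vanishing.1 (bernstein_mem_vanishing_left P a b j) k h, mul_zero]
  · exact fun h => absurd (Finset.mem_range.2 hk) h

theorem Disconjugate.bernsteinSum_apply_left (hP : Disconjugate P a b) (hab : a < b)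
    (hdeg : 0 < P.natDegree) (c : ℕ → ℝ) : bernsteinSum P a b c a = c 0 :=
  hP.jet_bernsteinSum_left hab hdeg fun _ hj => absurd hj (Nat.not_lt_zero _)

theorem Disconjugate.eq_zero_of_eqOn_zero (hP : Disconjugate P a b) (hab : a < b)
    {g : smoothFun ℝ} (hg : g ∈ solutions P) (h : Set.EqOn g 0 (Set.Icc a b)) : g = 0 := by
  obtain ⟨S, hS, h_card⟩ := (Set.Icc_infinite hab).exists_subset_card_eq P.natDegree
  exact hP g hg ⟨S, 1, fun x hx => ⟨hS hx, mem_vanishing_one.2 (h (hS hx))⟩, by simp [h_card]⟩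

theorem Disconjugate.coeff_eq_of_eqOn (hP : Disconjugate P a b) (hab : a < b) {c d : ℕ → ℝ}
    (h : Set.EqOn (bernsteinSum P a b c) (bernsteinSum P a b d) (Set.Icc a b)) {k : ℕ}
    (hk : k < P.natDegree) : c k = d k := by
  have h_sum : bernsteinSum P a b (c - d) = 0 :=
    hP.eq_zero_of_eqOn_zero hab (bernsteinSum_mem_solutions _) fun x hx => by
      rw [bernsteinSum_sub]
      exact sub_eq_zero.2 (h hx)
  suffices h_coeff : (c - d) k = 0 from sub_eq_zero.1 h_coeff
  induction k using Nat.strong_induction_on with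
  | _ k ih =>
    rw [← hP.jet_bernsteinSum_left hab hk fun j hj => ih j hj (hj.trans hk), h_sum, map_zero]

end BernsteinSum

section DerivativeFormula

variable {Q : ℝ[X]} {a b : ℝ}

theorem natDegree_X_sub_C_mul (hQ : Q ≠ 0) (r : ℝ) :
    ((X - C r) * Q).natDegree = Q.natDegree + 1 := by
  rw [natDegree_mul (X_sub_C_ne_zero r) hQ, natDegree_X_sub_C, add_comm]

theorem exists_aeval_X_sub_C_neg (r : ℝ) (hab : a < b) {u : smoothFun ℝ}
    (h_pos : ∀ x ∈ Set.Ioo a b, 0 < u x) (hb : u b = 0) :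
    ∃ x ∈ Set.Ioo a b, aeval (derivOp ℝ) (X - C r) u x < 0 := by
  by_contra! h
  obtain ⟨y, hy⟩ := Set.nonempty_Ioo.2 hab
  have h_deriv (x : ℝ) : HasDerivAt (fun z => Real.exp (-r * z) * u z)
      (Real.exp (-r * x) * aeval (derivOp ℝ) (X - C r) u x) x := by
    refine ((hasDerivAt_exp_mul (-r) x).mul (hasDerivAt_smoothFun u x)).congr_deriv ?_
    rw [aeval_X_sub_C_apply]
    change _ = Real.exp (-r * x) * (derivOp ℝ u x - r * u x)
    ring
  have h_mono : MonotoneOn (fun z => Real.exp (-r * z) * u z) (Set.Icc y b) :=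
    monotoneOn_of_hasDerivWithinAt_nonneg (convex_Icc y b)
      (fun x _ => (h_deriv x).continuousAt.continuousWithinAt)
      (fun x _ => (h_deriv x).hasDerivWithinAt) fun x hx => by
        rw [interior_Icc] at hx
        exact mul_nonneg (Real.exp_pos _).le (h x ⟨hy.1.trans hx.1, hx.2⟩)
  have h_le := h_mono (Set.left_mem_Icc.2 hy.2.le) (Set.right_mem_Icc.2 hy.2.le) hy.2.le
  simp only [hb, mul_zero] at h_le
  exact h_le.not_gt (mul_pos (Real.exp_pos _) (h_pos y hy))

theorem aeval_X_sub_C_bernstein_mem_solutions (r : ℝ) (k : ℕ) :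
    aeval (derivOp ℝ) (X - C r) (bernstein ((X - C r) * Q) a b k) ∈ solutions Q :=
  mem_solutions_mul.1 <| by
    rw [mul_comm Q]
    exact bernstein_mem_solutions _ a b k

theorem aeval_X_sub_C_bernstein_mem_vanishing_right (hQ : Q ≠ 0) (r : ℝ) (k : ℕ) :
    aeval (derivOp ℝ) (X - C r) (bernstein ((X - C r) * Q) a b k) ∈
      vanishing ℝ b (Q.natDegree - 1 - k) := by
  by_cases hk : k < Q.natDegree
  · refine aeval_mem_vanishing ?_ (bernstein_mem_vanishing_right _ a b k)
    rw [natDegree_X_sub_C, natDegree_X_sub_C_mul hQ]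
    omega
  · rw [show Q.natDegree - 1 - k = 0 by omega]
    exact mem_vanishing_zero b _

theorem Disconjugate.exists_aeval_X_sub_C_bernstein_neg (hQ : Disconjugate Q a b) (hab : a < b)
    (r : ℝ) {k : ℕ} (hk : k < Q.natDegree) :
    ∃ x ∈ Set.Ioo a b,
      aeval (derivOp ℝ) (X - C r) (bernstein ((X - C r) * Q) a b k) x < 0 := by
  have hdeg := natDegree_X_sub_C_mul hQ.ne_zero r
  exact exists_aeval_X_sub_C_neg r hab
    (fun x hx => (hQ.X_sub_C_mul r).bernstein_pos (by omega) hx)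
    (apply_eq_zero_of_mem_vanishing (by omega) (bernstein_mem_vanishing_right _ a b k))

theorem Disconjugate.exists_aeval_X_sub_C_bernstein_zero (hQ : Disconjugate Q a b) (hab : a < b)
    (r : ℝ) : ∃ κ : ℝ, (0 < Q.natDegree → 0 < κ) ∧
      aeval (derivOp ℝ) (X - C r) (bernstein ((X - C r) * Q) a b 0) = -κ • bernstein Q a b 0 := by
  have h_eq := hQ.eq_smul_bernstein hab (aeval_X_sub_C_bernstein_mem_solutions (a := a) r 0)
    (mem_vanishing_zero a _) (aeval_X_sub_C_bernstein_mem_vanishing_right hQ.ne_zero r 0)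
  refine ⟨-jet a 0 _, fun hdeg => ?_, by rw [neg_neg, ← h_eq]⟩
  obtain ⟨x, hx, h_neg⟩ := hQ.exists_aeval_X_sub_C_bernstein_neg hab r hdeg
  rw [h_eq] at h_neg
  exact neg_pos.2 (neg_of_mul_neg_left h_neg (hQ.bernstein_pos hdeg hx).le)

theorem Disconjugate.exists_aeval_X_sub_C_bernstein_succ (hQ : Disconjugate Q a b) (hab : a < b)
    (r : ℝ) {k : ℕ} (hk : k < Q.natDegree) : ∃ κ : ℝ, (k + 1 < Q.natDegree → 0 < κ) ∧
      aeval (derivOp ℝ) (X - C r) (bernstein ((X - C r) * Q) a b (k + 1)) =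
        bernstein Q a b k - κ • bernstein Q a b (k + 1) := by
  set u := bernstein ((X - C r) * Q) a b (k + 1) with hu
  have hu_left : u ∈ vanishing ℝ a (k + 1) := bernstein_mem_vanishing_left _ a b _
  have hDu_left : aeval (derivOp ℝ) (X - C r) u ∈ vanishing ℝ a k :=
    aeval_mem_vanishing (by rw [natDegree_X_sub_C]) hu_left
  have hDu_jet : jet a k (aeval (derivOp ℝ) (X - C r) u) = 1 := by
    rw [jet_X_sub_C, (mem_vanishing_succ.1 hu_left).2, mul_zero, sub_zero, hu,
      (hQ.X_sub_C_mul r).jet_bernstein_left hab]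
    rw [natDegree_X_sub_C_mul hQ.ne_zero]
    omega
  set g := aeval (derivOp ℝ) (X - C r) u - bernstein Q a b k with hg
  have hg_left : g ∈ vanishing ℝ a (k + 1) :=
    mem_vanishing_succ.2 ⟨sub_mem hDu_left (bernstein_mem_vanishing_left Q a b k), by
      rw [hg, map_sub, hDu_jet, hQ.jet_bernstein_left hab hk, sub_self]⟩
  have hg_right : g ∈ vanishing ℝ b (Q.natDegree - 1 - (k + 1)) :=
    sub_mem (aeval_X_sub_C_bernstein_mem_vanishing_right hQ.ne_zero r (k + 1))
      (vanishing_antitone b (by omega) (bernstein_mem_vanishing_right Q a b k))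
  have h_eq : aeval (derivOp ℝ) (X - C r) u =
      bernstein Q a b k - (-jet a (k + 1) g) • bernstein Q a b (k + 1) := by
    rw [neg_smul, sub_neg_eq_add, ← hQ.eq_smul_bernstein hab
      (sub_mem (aeval_X_sub_C_bernstein_mem_solutions r _) (bernstein_mem_solutions Q a b k))
      hg_left hg_right, add_sub_cancel]
  refine ⟨_, fun hk' => ?_, h_eq⟩
  obtain ⟨x, hx, h_neg⟩ := hQ.exists_aeval_X_sub_C_bernstein_neg hab r hk'
  rw [h_eq] at h_neg
  have h_lt := (hQ.bernstein_pos hk hx).trans (sub_neg.1 h_neg)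
  exact pos_of_mul_pos_left h_lt (hQ.bernstein_pos hk' hx).le

theorem Disconjugate.exists_aeval_X_sub_C_bernsteinSum (hQ : Disconjugate Q a b) (hab : a < b)
    (r : ℝ) : ∃ κ : ℕ → ℝ, (∀ k < Q.natDegree, 0 < κ k) ∧ ∀ c : ℕ → ℝ,
      aeval (derivOp ℝ) (X - C r) (bernsteinSum ((X - C r) * Q) a b c) =
        bernsteinSum Q a b fun k => c (k + 1) - κ k * c k := by
  obtain ⟨κ₀, hκ₀, h_zero⟩ := hQ.exists_aeval_X_sub_C_bernstein_zero hab r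
  choose! κ hκ h_succ using fun k => hQ.exists_aeval_X_sub_C_bernstein_succ hab r (k := k)
  let κ' : ℕ → ℝ := fun k => k.casesOn κ₀ κ
  refine ⟨κ', fun k hk => ?_, fun c => ?_⟩
  · cases k with
    | zero => exact hκ₀ hk
    | succ k => exact hκ k (Nat.lt_of_succ_lt hk) hk
  · have h_last : bernstein Q a b Q.natDegree = 0 := hQ.bernstein_eq_zero hab le_rfl
    have h_tail : ∑ k ∈ Finset.range (Q.natDegree + 1), (κ' k * c k) • bernstein Q a b k =
        ∑ k ∈ Finset.range Q.natDegree, (κ' k * c k) • bernstein Q a b k := by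
      rw [Finset.sum_range_succ, h_last, smul_zero, add_zero]
    have h_head : ∑ k ∈ Finset.range Q.natDegree,
        c (k + 1) • aeval (derivOp ℝ) (X - C r) (bernstein ((X - C r) * Q) a b (k + 1)) =
        ∑ k ∈ Finset.range Q.natDegree, (c (k + 1) • bernstein Q a b k -
          (κ' (k + 1) * c (k + 1)) • bernstein Q a b (k + 1)) :=
      Finset.sum_congr rfl fun k hk => by
        rw [h_succ k (Finset.mem_range.1 hk), smul_sub, smul_smul, mul_comm]
    simp only [bernsteinSum, natDegree_X_sub_C_mul hQ.ne_zero, sub_smul, Finset.sum_sub_distrib,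
      map_sum (aeval (derivOp ℝ) (X - C r)), map_smul]
    rw [← h_tail, Finset.sum_range_succ', Finset.sum_range_succ', h_zero, h_head,
      sub_add_eq_sub_sub, ← Finset.sum_sub_distrib, smul_smul, mul_neg, neg_smul,
      ← sub_eq_add_neg, mul_comm (c 0)]
    rfl

theorem eq_of_aeval_X_sub_C_eq {r x₀ : ℝ} {f g : smoothFun ℝ}
    (h : aeval (derivOp ℝ) (X - C r) f = aeval (derivOp ℝ) (X - C r) g) (h₀ : f x₀ = g x₀) :
    f = g := by
  refine sub_eq_zero.1 (eq_zero_of_mem_solutions_of_mem_vanishing (X_sub_C_ne_zero r)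
    (x₀ := x₀) (mem_solutions.2 (by rw [map_sub, h, sub_self])) ?_)
  rw [natDegree_X_sub_C, mem_vanishing_one]
  exact sub_eq_zero.2 h₀

end DerivativeFormula

section Exponentials

variable {Q R : ℝ[X]} {a b : ℝ}

/-- The function `x ↦ e^{r x}`. -/
noncomputable def realExp (r : ℝ) : smoothFun ℝ := ⟨fun x => Real.exp (r * x), by
  change ContDiff ℝ ∞ _
  fun_prop⟩

/-- The function `x ↦ x e^{r x}`. -/
noncomputable def realMulExp (r : ℝ) : smoothFun ℝ := ⟨fun x => x * Real.exp (r * x), by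
  change ContDiff ℝ ∞ _
  fun_prop⟩

theorem aeval_realExp (r : ℝ) : aeval (derivOp ℝ) (X - C r) (realExp r) = 0 := by
  rw [aeval_X_sub_C_apply, sub_eq_zero]
  exact derivOp_eq_of_hasDerivAt (hasDerivAt_exp_mul r)

theorem aeval_realMulExp (r : ℝ) :
    aeval (derivOp ℝ) (X - C r) (realMulExp r) = realExp r := by
  rw [aeval_X_sub_C_apply, sub_eq_iff_eq_add]
  refine derivOp_eq_of_hasDerivAt fun x =>
    ((hasDerivAt_id x).mul (hasDerivAt_exp_mul r x)).congr_deriv ?_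
  change 1 * Real.exp (r * x) + x * (r * Real.exp (r * x)) =
    Real.exp (r * x) + r * (x * Real.exp (r * x))
  ring

theorem Disconjugate.exists_bernsteinSum_eq_realExp (hQ : Disconjugate Q a b) (hab : a < b)
    (r : ℝ) : ∃ c : ℕ → ℝ, (∀ k ≤ Q.natDegree, 0 < c k) ∧
      bernsteinSum ((X - C r) * Q) a b c = realExp r := by
  obtain ⟨κ, hκ, h_deriv⟩ := hQ.exists_aeval_X_sub_C_bernsteinSum hab r
  let c : ℕ → ℝ := fun k => Real.exp (r * a) * ∏ j ∈ Finset.range k, κ j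
  have hc_succ (k : ℕ) : c (k + 1) - κ k * c k = 0 := by
    simp only [c, Finset.prod_range_succ]
    ring
  refine ⟨c, fun k hk => mul_pos (Real.exp_pos _) (Finset.prod_pos fun j hj => hκ j ?_),
    eq_of_aeval_X_sub_C_eq (r := r) (x₀ := a) ?_ ?_⟩
  · exact (Finset.mem_range.1 hj).trans_le hk
  · rw [aeval_realExp, h_deriv, funext hc_succ]
    exact bernsteinSum_zero
  · rw [(hQ.X_sub_C_mul r).bernsteinSum_apply_left hab (natDegree_X_sub_C_mul hQ.ne_zero r ▸
      Nat.succ_pos _)]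
    change Real.exp (r * a) * ∏ j ∈ Finset.range 0, κ j = Real.exp (r * a)
    rw [Finset.prod_range_zero, mul_one]

theorem Disconjugate.exists_node_increment (hR : Disconjugate R a b) (hab : a < b) {r : ℝ}
    {c : ℕ → ℝ} (hc_pos : ∀ k ≤ R.natDegree + 1, 0 < c k)
    (hc : bernsteinSum ((X - C r) * ((X - C r) * R)) a b c = realExp r) :
    ∃ δ : ℕ → ℝ, (∀ k ≤ R.natDegree, 0 < δ k) ∧ ∀ s : ℕ → ℝ,
      (∀ k ≤ R.natDegree, s (k + 1) = s k + δ k) →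
      aeval (derivOp ℝ) (X - C r) (bernsteinSum ((X - C r) * ((X - C r) * R)) a b (c * s)) =
        realExp r := by
  have hQ := hR.X_sub_C_mul r
  have hdeg := natDegree_X_sub_C_mul hR.ne_zero r
  obtain ⟨γ, hγ_pos, hγ⟩ := hR.exists_bernsteinSum_eq_realExp hab r
  obtain ⟨κ, -, h_deriv⟩ := hQ.exists_aeval_X_sub_C_bernsteinSum hab r
  have hc_succ (k) (hk : k ≤ R.natDegree) : c (k + 1) - κ k * c k = 0 := by
    refine hQ.coeff_eq_of_eqOn hab (c := fun k => c (k + 1) - κ k * c k) (d := 0)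
      (fun x _ => ?_) (by omega)
    rw [← h_deriv, hc, aeval_realExp, bernsteinSum_zero]
  refine ⟨fun k => γ k / c (k + 1), fun k hk => div_pos (hγ_pos k hk) (hc_pos _ (by omega)),
    fun s hs => ?_⟩
  rw [h_deriv, ← hγ]
  refine bernsteinSum_congr fun k hk => ?_
  have hk' : k ≤ R.natDegree := by omega
  have hc_ne : c (k + 1) ≠ 0 := (hc_pos _ (by omega)).ne'
  calc c (k + 1) * s (k + 1) - κ k * (c k * s k)
      = c (k + 1) * (γ k / c (k + 1)) + (c (k + 1) - κ k * c k) * s k := by rw [hs k hk']; ring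
    _ = γ k := by rw [hc_succ k hk', zero_mul, add_zero, mul_div_cancel₀ _ hc_ne]

theorem Disconjugate.exists_nodes (hR : Disconjugate R a b) (hab : a < b) (r : ℝ) :
    ∃ c s : ℕ → ℝ, (∀ k ≤ R.natDegree + 1, 0 < c k) ∧
      s 0 = a ∧ s (R.natDegree + 1) = b ∧ (∀ k ≤ R.natDegree, s k < s (k + 1)) ∧
      bernsteinSum ((X - C r) * ((X - C r) * R)) a b c = realExp r ∧
      bernsteinSum ((X - C r) * ((X - C r) * R)) a b (c * s) = realMulExp r := by
  have hQ := hR.X_sub_C_mul r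
  have hdegQ := natDegree_X_sub_C_mul hR.ne_zero r
  have hdegP := natDegree_X_sub_C_mul hQ.ne_zero r
  obtain ⟨c, hc_pos, hc⟩ := hQ.exists_bernsteinSum_eq_realExp hab r
  rw [hdegQ] at hc_pos hdegP
  obtain ⟨δ, hδ, h_deriv⟩ := hR.exists_node_increment hab hc_pos hc
  let s : ℕ → ℝ := fun k => a + ∑ j ∈ Finset.range k, δ j
  have hs_zero : s 0 = a := by simp only [s, Finset.sum_range_zero, add_zero]
  have hs_succ (k : ℕ) : s (k + 1) = s k + δ k := by
    simp only [s, Finset.sum_range_succ, add_assoc]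
  have h_left (d : ℕ → ℝ) : bernsteinSum ((X - C r) * ((X - C r) * R)) a b d a = d 0 :=
    (hQ.X_sub_C_mul r).bernsteinSum_apply_left hab (by omega) d
  have h_mulExp : bernsteinSum ((X - C r) * ((X - C r) * R)) a b (c * s) = realMulExp r := by
    refine eq_of_aeval_X_sub_C_eq (r := r) (x₀ := a) ?_ ?_
    · rw [h_deriv s fun k _ => hs_succ k, aeval_realMulExp]
    · rw [h_left, Pi.mul_apply, hs_zero, ← h_left c, hc, mul_comm]
      rfl
  refine ⟨c, s, hc_pos, hs_zero, ?_, fun k hk => ?_, hc, h_mulExp⟩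
  · have hb_exp := bernsteinSum_apply_right hdegP c (a := a) (b := b)
    have hb_mulExp := bernsteinSum_apply_right hdegP (c * s) (a := a) (b := b)
    rw [hc] at hb_exp
    rw [h_mulExp] at hb_mulExp
    change Real.exp (r * b) = _ at hb_exp
    change b * Real.exp (r * b) = c _ * s _ * _ at hb_mulExp
    refine mul_right_cancel₀ (Real.exp_ne_zero (r * b)) ?_
    rw [hb_mulExp, hb_exp]
    ring
  · rw [hs_succ]
    exact lt_add_of_pos_right _ (hδ k hk)

end Exponentials

section CharPoly

variable {n : ℕ} {Λ : Fin (n + 1) → ℂ} {a b : ℝ}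

/-- The characteristic polynomial of `(d/dx - λ₀) ⋯ (d/dx - λₙ)`. -/
noncomputable def charPoly (Λ : Fin (n + 1) → ℂ) : ℂ[X] := ∏ j, (X - C (Λ j))

theorem isMonicOfDegree_charPoly (Λ : Fin (n + 1) → ℂ) : IsMonicOfDegree (charPoly Λ) (n + 1) := by
  have h_card : ∑ _j : Fin (n + 1), 1 = n + 1 := by simp
  rw [← h_card]
  exact ⟨natDegree_prod_of_monic _ _ (fun j _ => monic_X_sub_C (Λ j)) |>.trans
    (Finset.sum_congr rfl fun j _ => natDegree_X_sub_C (Λ j)),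
    monic_prod_of_monic _ _ fun j _ => monic_X_sub_C (Λ j)⟩

theorem foldr_firstOrderOp (l : List ℂ) (f : smoothFun ℂ) :
    l.foldr firstOrderOp f = aeval (derivOp ℂ) (l.map fun c => X - C c).prod f := by
  induction l with
  | nil => simp only [List.foldr_nil, List.map_nil, List.prod_nil, map_one, Module.End.one_apply]
  | cons c l ih =>
    rw [List.foldr_cons, ih, List.map_cons, List.prod_cons, aeval_mul_apply, aeval_X_sub_C_apply]
    rfl

theorem diffOp_eq_aeval (Λ : Fin (n + 1) → ℂ) (f : smoothFun ℂ) :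
    diffOp Λ f = aeval (derivOp ℂ) (charPoly Λ) f := by
  rw [diffOp, foldr_firstOrderOp, List.map_ofFn, List.prod_ofFn]
  rfl

theorem mem_expSpace_iff {f : smoothFun ℂ} :
    (f : ℝ → ℂ) ∈ expSpace Λ ↔ f ∈ solutions (charPoly Λ) := by
  refine (and_iff_right (contDiff_smoothFun f)).trans ?_
  rw [diffOp_eq_aeval, mem_solutions, ← funext_iff]
  exact ⟨fun h => Subtype.ext h, congrArg Subtype.val⟩

theorem map_conj_charPoly (hconj : ClosedUnderConj (expSpace Λ)) :
    (charPoly Λ).map (starRingEnd ℂ) = charPoly Λ := by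
  have h_monic := isMonicOfDegree_charPoly Λ
  have h_monic' : IsMonicOfDegree ((charPoly Λ).map (starRingEnd ℂ)) (n + 1) :=
    ⟨(natDegree_map _).trans h_monic.natDegree_eq, h_monic.monic.map _⟩
  have h_le : solutions (charPoly Λ) ≤ solutions ((charPoly Λ).map (starRingEnd ℂ)) := by
    intro f hf
    have h_conj : postComp (Complex.conjCLE : ℂ →L[ℝ] ℂ) f ∈ solutions (charPoly Λ) :=
      mem_expSpace_iff.1 (hconj f (mem_expSpace_iff.2 hf))
    have h_conj_conj : postComp (Complex.conjCLE : ℂ →L[ℝ] ℂ) (postComp Complex.conjCLE f) = f :=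
      Subtype.ext <| funext fun x => Complex.conj_conj (f x)
    rw [← h_conj_conj]
    refine postComp_mem_solutions (h_monic.natDegree_eq.trans h_monic'.natDegree_eq.symm)
      (fun k z => ?_) h_conj
    rw [coeff_map]
    exact map_mul (starRingEnd ℂ) _ _
  refine sub_eq_zero.1 (eq_zero_of_solutions_le h_monic.ne_zero (fun f hf => ?_) ?_)
  · rw [mem_solutions, map_sub, LinearMap.sub_apply, mem_solutions.1 (h_le hf), mem_solutions.1 hf,
      sub_zero]
  · rw [h_monic.natDegree_eq]
    exact h_monic'.natDegree_sub_lt n.succ_ne_zero h_monic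

theorem exists_map_eq_charPoly (hconj : ClosedUnderConj (expSpace Λ)) :
    ∃ P : ℝ[X], P.map (algebraMap ℝ ℂ) = charPoly Λ := by
  refine (mem_lifts _).1 ((lifts_iff_coeff_lifts _).2 fun k => ?_)
  have h_coeff : conj ((charPoly Λ).coeff k) = (charPoly Λ).coeff k := by
    rw [← coeff_map, map_conj_charPoly hconj]
  obtain ⟨y, hy⟩ := Complex.conj_eq_iff_real.1 h_coeff
  exact ⟨y, hy.symm⟩

theorem abs_im_mul_lt_pi (hab : 0 < b - a)
    (hM : maxAbsIm Λ ≠ 0 → b - a < Real.pi / maxAbsIm Λ) (j : Fin (n + 1)) :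
    |(Λ j).im| * (b - a) < Real.pi := by
  have h_le : |(Λ j).im| ≤ maxAbsIm Λ :=
    Finset.le_sup' (fun i => |(Λ i).im|) (Finset.mem_univ j)
  rcases ((abs_nonneg _).trans h_le).eq_or_lt with h_zero | h_pos
  · rw [le_antisymm (h_zero ▸ h_le) (abs_nonneg _), zero_mul]
    exact Real.pi_pos
  · calc |(Λ j).im| * (b - a) ≤ maxAbsIm Λ * (b - a) := by gcongr
      _ < Real.pi := by rw [mul_comm]; exact (lt_div_iff₀ h_pos).1 (hM h_pos.ne')

theorem sq_X_sub_C_dvd (hn : 1 ≤ n) (h01 : Λ 0 = Λ 1) {r : ℝ} (hr : Λ 0 = r) {P : ℝ[X]}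
    (hP : P.map (algebraMap ℝ ℂ) = charPoly Λ) : (X - C r) * (X - C r) ∣ P := by
  obtain ⟨m, rfl⟩ := Nat.exists_eq_add_of_le' hn
  rw [← map_dvd_map' (algebraMap ℝ ℂ), hP, charPoly, Fin.prod_univ_succ, Fin.prod_univ_succ,
    ← mul_assoc, Fin.succ_zero_eq_one, ← h01, hr]
  simp

theorem exists_disconjugate_cofactor (hn : 1 ≤ n) (h01 : Λ 0 = Λ 1) {r : ℝ} (hr : Λ 0 = r)
    (hconj : ClosedUnderConj (expSpace Λ)) (hab : 0 < b - a)
    (hM : maxAbsIm Λ ≠ 0 → b - a < Real.pi / maxAbsIm Λ) :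
    ∃ R : ℝ[X], Disconjugate R a b ∧
      ((X - C r) * ((X - C r) * R)).map (algebraMap ℝ ℂ) = charPoly Λ := by
  obtain ⟨P, hP⟩ := exists_map_eq_charPoly hconj
  obtain ⟨R, rfl⟩ := sq_X_sub_C_dvd hn h01 hr hP
  refine ⟨R, disconjugate_of_forall_abs_im_lt ?_ fun z hz => ?_, by rw [← mul_assoc, hP]⟩
  · rintro rfl
    rw [mul_zero, Polynomial.map_zero] at hP
    exact (isMonicOfDegree_charPoly Λ).ne_zero hP.symm
  · have h_eval : (charPoly Λ).eval z = 0 := by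
      rw [← hP, eval_map_algebraMap, map_mul, hz, mul_zero]
    rw [charPoly, eval_prod] at h_eval
    obtain ⟨j, -, hj⟩ := Finset.prod_eq_zero_iff.1 h_eval
    rw [eval_sub, eval_X, eval_C, sub_eq_zero] at hj
    exact hj ▸ abs_im_mul_lt_pi hab hM j

theorem natDegree_cofactor {R : ℝ[X]} (hR : R ≠ 0) {r : ℝ}
    (hP : ((X - C r) * ((X - C r) * R)).map (algebraMap ℝ ℂ) = charPoly Λ) :
    R.natDegree + 1 = n := by
  have hdeg := congrArg natDegree hP
  rw [natDegree_map, (isMonicOfDegree_charPoly Λ).natDegree_eq,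
    natDegree_X_sub_C_mul (mul_ne_zero (X_sub_C_ne_zero r) hR), natDegree_X_sub_C_mul hR] at hdeg
  exact Nat.succ_injective hdeg

end CharPoly

section BernsteinBasis

variable {n : ℕ} {Λ : Fin (n + 1) → ℂ} {P : ℝ[X]} {a b : ℝ}

/-- The first `n + 1` Bernstein functions of `P(d/dx) u = 0`, as complex-valued functions; these are
all of them if `deg P = n + 1`. -/
noncomputable def bernsteinBasis (n : ℕ) (P : ℝ[X]) (a b : ℝ) : Fin (n + 1) → ℝ → ℂ :=
  fun k x => bernstein P a b k x

theorem Disconjugate.eq_smul_postComp_bernstein (hP : Disconjugate P a b) (hab : a < b) {k : ℕ}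
    {g : smoothFun ℂ} (hg : g ∈ solutions (P.map (algebraMap ℝ ℂ))) (ha : g ∈ vanishing ℂ a k)
    (hb : g ∈ vanishing ℂ b (P.natDegree - 1 - k)) :
    g = jet a k g • postComp Complex.ofRealCLM (bernstein P a b k) := by
  have h_part (ℓ : ℂ →L[ℝ] ℝ) (x : ℝ) : ℓ (g x) = ℓ (jet a k g) * bernstein P a b k x := by
    rw [← jet_postComp]
    exact congrFun (congrArg Subtype.val (hP.eq_smul_bernstein hab
      (postComp_mem_solutions_real (ℓ := ℓ) hg) (postComp_mem_vanishing ℓ ha)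
      (postComp_mem_vanishing ℓ hb))) x
  ext x
  change g x = jet a k g * (bernstein P a b k x : ℂ)
  refine Complex.ext ?_ ?_
  · rw [Complex.re_mul_ofReal]
    exact h_part Complex.reCLM x
  · rw [Complex.im_mul_ofReal]
    exact h_part Complex.imCLM x

theorem Disconjugate.isBernsteinBasis_iff (hD : Disconjugate P a b) (hab : a < b)
    (hP : P.map (algebraMap ℝ ℂ) = charPoly Λ) {p : Fin (n + 1) → ℝ → ℂ} :
    IsBernsteinBasis Λ a b p ↔ p = bernsteinBasis n P a b := by
  have hdeg : P.natDegree = n + 1 := by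
    rw [← natDegree_map (algebraMap ℝ ℂ), hP, (isMonicOfDegree_charPoly Λ).natDegree_eq]
  constructor
  · refine fun h => funext fun k => ?_
    obtain ⟨h_mem, h_left, h_right, h_jet⟩ := h k
    let g : smoothFun ℂ := ⟨p k, h_mem.1⟩
    have hg : g ∈ solutions (P.map (algebraMap ℝ ℂ)) := hP ▸ mem_expSpace_iff.1 h_mem
    have h_eq := hD.eq_smul_postComp_bernstein hab hg
      (mem_vanishing.2 fun j hj => (jet_eq_iteratedDeriv a j g).trans (h_left.1 j hj))
      (mem_vanishing.2 fun j hj => (jet_eq_iteratedDeriv b j g).trans (h_right.1 j (by omega)))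
    rw [jet_eq_iteratedDeriv, show iteratedDeriv k g a = 1 from h_jet, one_smul] at h_eq
    exact congrArg Subtype.val h_eq
  · rintro rfl k
    have hk : (k : ℕ) < P.natDegree := by omega
    let g : smoothFun ℂ := postComp Complex.ofRealCLM (bernstein P a b k)
    have h_deriv (x : ℝ) (j : ℕ) :
        iteratedDeriv j (bernsteinBasis n P a b k) x = jet x j (bernstein P a b k) :=
      (jet_eq_iteratedDeriv x j g).symm.trans (jet_postComp _ _ x j)
    have hg : g ∈ solutions (charPoly Λ) := hP ▸ postComp_mem_solutions (natDegree_map _).symm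
      (fun j z => by simp) (bernstein_mem_solutions P a b k)
    have h_right : P.natDegree - 1 - k = n - k := by omega
    refine ⟨mem_expSpace_iff.2 hg, ⟨fun j hj => ?_, ?_⟩, ⟨fun j hj => ?_, ?_⟩, ?_⟩
    · rw [h_deriv, mem_vanishing.1 (bernstein_mem_vanishing_left P a b k) j hj, Complex.ofReal_zero]
    · rw [h_deriv, hD.jet_bernstein_left hab hk, Complex.ofReal_one]
      exact one_ne_zero
    · rw [h_deriv, mem_vanishing.1 (bernstein_mem_vanishing_right P a b k) j (h_right ▸ hj),
        Complex.ofReal_zero]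
    · rw [h_deriv, Complex.ofReal_ne_zero, ← h_right]
      exact hD.jet_bernstein_right_ne_zero hab hk
    · rw [h_deriv, hD.jet_bernstein_left hab hk, Complex.ofReal_one]

end BernsteinBasis

section BernsteinOperator

variable {n : ℕ} {P R : ℝ[X]} {a b : ℝ} {t : Fin (n + 1) → Set.Icc a b} {α : Fin (n + 1) → ℝ}
  {g : C(ℝ, ℂ)} {G : smoothFun ℝ} {c : ℕ → ℝ}

theorem bernsteinOp_bernsteinBasis (hdeg : P.natDegree = n + 1) (hG : ∀ x, g x = (G x : ℂ))
    (hc : ∀ k : Fin (n + 1), α k * G (t k) = c k) (x : ℝ) :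
    bernsteinOp (bernsteinBasis n P a b) t α (g.restrict (Set.Icc a b)) x =
      (bernsteinSum P a b c x : ℂ) := by
  simp only [bernsteinOp, bernsteinBasis]
  rw [bernsteinSum_apply, hdeg, ← Fin.sum_univ_eq_sum_range (fun k => c k * bernstein P a b k x),
    Complex.ofReal_sum]
  refine Finset.sum_congr rfl fun k _ => ?_
  rw [ContinuousMap.restrict_apply, hG, ← hc, ← Complex.ofReal_mul, ← Complex.ofReal_mul]

theorem Disconjugate.fixesOn_iff (hP : Disconjugate P a b) (hab : a < b)
    (hdeg : P.natDegree = n + 1) (hG : ∀ x, g x = (G x : ℂ)) (hc : bernsteinSum P a b c = G)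
    {S : Set ℝ} (hS : Set.Icc a b ⊆ S) :
    FixesOn (bernsteinBasis n P a b) t α g S ↔ ∀ k : Fin (n + 1), α k * G (t k) = c k := by
  refine ⟨fun h k => ?_, fun h x _ => by rw [bernsteinOp_bernsteinBasis hdeg hG h, hc, hG]⟩
  let d : ℕ → ℝ := Function.extend Fin.val (fun k : Fin (n + 1) => α k * G (t k)) 0
  have hd (k : Fin (n + 1)) : α k * G (t k) = d k := by
    simp only [d, Fin.val_injective.extend_apply]
  rw [hd]
  refine hP.coeff_eq_of_eqOn hab (fun x hx => Complex.ofReal_injective ?_) (by omega)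
  rw [← bernsteinOp_bernsteinBasis hdeg hG hd, h x (hS hx), hG, hc]

theorem expFun_ofReal (r x : ℝ) : expFun r x = (realExp r x : ℂ) := by
  simp [expFun, realExp]

theorem mulExpFun_ofReal (r x : ℝ) : mulExpFun r x = (realMulExp r x : ℂ) := by
  simp [mulExpFun, realMulExp]

theorem mul_realExp_eq_and_mul_realMulExp_eq_iff {r w x c s : ℝ} (hc : c ≠ 0) :
    w * realExp r x = c ∧ w * realMulExp r x = c * s ↔ x = s ∧ w = c / realExp r s := by
  have h_exp (y : ℝ) : realExp r y ≠ 0 := Real.exp_ne_zero _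
  have h_mulExp : w * realMulExp r x = w * realExp r x * x := by
    change w * (x * Real.exp (r * x)) = w * Real.exp (r * x) * x
    ring
  constructor
  · rintro ⟨rfl, h⟩
    obtain rfl : x = s := mul_left_cancel₀ hc (h_mulExp.symm.trans h)
    exact ⟨rfl, (mul_div_cancel_right₀ w (h_exp x)).symm⟩
  · rintro ⟨rfl, rfl⟩
    rw [h_mulExp, div_mul_cancel₀ c (h_exp x)]
    exact ⟨rfl, rfl⟩

theorem Disconjugate.exists_admissibleData (hR : Disconjugate R a b) (hab : a < b) (r : ℝ)
    (hdeg : R.natDegree + 1 = n) :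
    ∃ (t : Fin (n + 1) → Set.Icc a b) (α : Fin (n + 1) → ℝ), AdmissibleData t α ∧
      ∀ (S : Set ℝ), Set.Icc a b ⊆ S → ∀ t' α',
        FixesOn (bernsteinBasis n ((X - C r) * ((X - C r) * R)) a b) t' α' (expFun r) S ∧
        FixesOn (bernsteinBasis n ((X - C r) * ((X - C r) * R)) a b) t' α' (mulExpFun r) S ↔
        t' = t ∧ α' = α := by
  subst hdeg
  have hQ := hR.X_sub_C_mul r
  have hdeg : ((X - C r) * ((X - C r) * R)).natDegree = R.natDegree + 1 + 1 := by
    rw [natDegree_X_sub_C_mul hQ.ne_zero, natDegree_X_sub_C_mul hR.ne_zero]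
  obtain ⟨c, s, hc_pos, hs_zero, hs_last, hs_lt, h_exp, h_mulExp⟩ := hR.exists_nodes hab r
  have hs_mono : Monotone fun k : Fin (R.natDegree + 1 + 1) => s k :=
    Fin.monotone_iff_le_succ.2 fun i => (hs_lt i (by omega)).le
  have hs_mem (k : Fin (R.natDegree + 1 + 1)) : s k ∈ Set.Icc a b :=
    ⟨hs_zero ▸ hs_mono (Fin.zero_le k), hs_last ▸ hs_mono (Fin.le_last k)⟩
  refine ⟨fun k => ⟨s k, hs_mem k⟩, fun k => c k / realExp r (s k),
    ⟨hs_zero, hs_last, hs_mono, fun k => div_pos (hc_pos k (by omega)) (Real.exp_pos _)⟩,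
    fun S hS t' α' => ?_⟩
  have hP := hQ.X_sub_C_mul r
  rw [hP.fixesOn_iff hab hdeg (expFun_ofReal r) h_exp hS,
    hP.fixesOn_iff hab hdeg (mulExpFun_ofReal r) h_mulExp hS, ← forall_and, funext_iff, funext_iff,
    ← forall_and]
  exact forall_congr' fun k => (mul_realExp_eq_and_mul_realMulExp_eq_iff
    (hc_pos k (by omega)).ne').trans (and_congr_left' Subtype.mk_eq_mk.symm)

end BernsteinOperator

end ExpBernstein

theorem theorem3p8 (n : ℕ) (hn : 1 ≤ n) (Λ : Fin (n + 1) → ℂ)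
    (h01 : Λ 0 = Λ 1) (hreal : (Λ 0).im = 0)
    (hconj : ExpBernstein.ClosedUnderConj (ExpBernstein.expSpace Λ))
    (a b : ℝ) (hab : 0 < b - a)
    -- `b - a < π / Mₙ`, with `π / 0 = ∞`
    (hM : ExpBernstein.maxAbsIm Λ ≠ 0 → b - a < Real.pi / ExpBernstein.maxAbsIm Λ) :
    (∃! p : Fin (n + 1) → ℝ → ℂ, ExpBernstein.IsBernsteinBasis Λ a b p) ∧
    ∀ p : Fin (n + 1) → ℝ → ℂ, ExpBernstein.IsBernsteinBasis Λ a b p →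
      ∃ (t : Fin (n + 1) → Set.Icc a b) (α : Fin (n + 1) → ℝ),
        (ExpBernstein.AdmissibleData t α ∧
          ExpBernstein.FixesOn p t α (ExpBernstein.expFun (Λ 0)) Set.univ ∧
          ExpBernstein.FixesOn p t α (ExpBernstein.mulExpFun (Λ 0)) Set.univ) ∧
        ∀ (t' : Fin (n + 1) → Set.Icc a b) (α' : Fin (n + 1) → ℝ),
          ExpBernstein.AdmissibleData t' α' →
          ExpBernstein.FixesOn p t' α' (ExpBernstein.expFun (Λ 0)) (Set.Icc a b) →
          ExpBernstein.FixesOn p t' α' (ExpBernstein.mulExpFun (Λ 0)) (Set.Icc a b) →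
          t' = t ∧ α' = α := by
  have hab' : a < b := sub_pos.1 hab
  have hr : Λ 0 = ((Λ 0).re : ℂ) := Complex.ext rfl hreal
  obtain ⟨R, hR, hP⟩ := ExpBernstein.exists_disconjugate_cofactor hn h01 hr hconj hab hM
  have h_basis := fun p => ((hR.X_sub_C_mul _).X_sub_C_mul _).isBernsteinBasis_iff hab' hP (p := p)
  refine ⟨⟨_, (h_basis _).2 rfl, fun p hp => (h_basis p).1 hp⟩, fun p hp => ?_⟩
  obtain rfl := (h_basis p).1 hp
  obtain ⟨t, α, h_adm, h_fixes⟩ := hR.exists_admissibleData hab' (Λ 0).re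
    (ExpBernstein.natDegree_cofactor hR.ne_zero hP)
  rw [hr]
  exact ⟨t, α, ⟨h_adm, (h_fixes _ (Set.subset_univ _) t α).2 ⟨rfl, rfl⟩⟩,
    fun t' α' _ h_exp h_mulExp => (h_fixes _ subset_rfl t' α').1 ⟨h_exp, h_mulExp⟩⟩
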